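/- Setting. Let $(\Omega,\mathcal A,\mathbb P)$ be a probability space, $Y\in\mathbb R^d$ and $Z\in\mathbb R^q$ independent random variables, $\varphi\colon\mathbb R^d\times\mathbb R^q\to\mathbb R$ measurable with $\varphi(Y,Z)\in L^2(\mathbb P)$, and $\alpha\in(0,1)$. Let $\mathcal H=\{1/K: K\in\mathbb N, K\ge1\}$ and $\overline{\mathcal H}=\mathcal H\cup\{0\}$. Put $X_0=\mathbb E[\varphi(Y,Z)\mid Y]$ and, for $h=1/K\in\mathcal H$, $X_h=\frac1K\sum_{k=1}^K\varphi(Y,Z^{(k)})$ with $Z^{(1)},\dots,Z^{(K)}$ iid copies of $Z$ independent of $Y$. For $h\in\overline{\mathcal H}$ let $F_{X_h}$ be the distribution function of $X_h$, $V_h(\xi)=\xi+\frac1{1-\alpha}\mathbb E[(X_h-\xi)^+]$, $\Theta_h=\operatorname{Argmin}V_h$, $\xi^h_\star\in\Theta_h$ and $\chi^h_\star=\min V_h$. Assumptions on the losses. (A1) There are functions $v$ and $w(\cdot,h)$, $h\in\mathcal H$, such that $F_{X_h}(\xi)-F_{X_0}(\xi)=v(\xi)h+w(\xi,h)h$ for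 all $\xi\in\mathbb R$, $h\in\mathcal H$, and such that for any $\xi^0_\star\in\Theta_0$ the functions $v$ and $w(\cdot,h)$ are integrable on $(\xi^0_\star,\infty)$ and $w(\xi^0_\star,h)\to0$, $\int_{\xi^0_\star}^\infty w(\xi,h)\,\mathrm d\xi\to0$ as $\mathcal H\ni h\downarrow0$. (A2) For any $h\in\overline{\mathcal H}$, $X_h$ has a continuous density $f_{X_h}$, and $f_{X_h}\to f_{X_0}$ locally uniformly as $\mathcal H\ni h\downarrow0$. (A3) For any $R>0$, $\inf\{f_{X_h}(\xi): h\in\overline{\mathcal H},\ |\xi-\xi^0_\star|<R\}>0$. (A4) The densities $(f_{X_h})_{h\in\overline{\mathcal H}}$ are uniformly bounded and uniformly Lipschitz. Algorithm. For $h=1/K\in\mathcal H$ and a square integrable initial pair $(\xi^h_0,\chi^h_0)$, the nested SA algorithm performs, for $n\ge0$, $$\xi^h_{n+1}=\xi^h_n-\gamma_{n+1}\Big(1-\tfrac1{1-\alpha}\mathbf 1_{X_h^{(n+1)}\ge\xi^h_n}\Big),\qquad \chi^h_{n+1}=\chi^h_n-\tfrac1{n+1}\Big(\chi^h_n-\xi^h_n-\tfrac1{1-\alpha}(X_h^{(n+1)}-\xi^h_n)^+\Big),$$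 where $X_h^{(n+1)}=\frac1K\sum_{k=1}^K\varphi(Y^{(n+1)},Z^{(n+1,k)})$ is computed from fresh independent copies of $Y$ and $Z$, and the initial pair is independent of all the samples. With $k_\alpha=1\vee\frac\alpha{1-\alpha}$, assume $$\sup_{h\in\mathcal H}\mathbb E\Big[|\xi^h_0|^2\exp\Big(\tfrac4{1-\alpha}k_\alpha\sup_{h'\in\overline{\mathcal H}}\|f_{X_{h'}}\|_\infty|\xi^h_0|\Big)\Big]+\sup_{h\in\mathcal H}\mathbb E[|\chi^h_0|]<\infty .$$ Let $$\bar\lambda_1=\inf_{h\in\overline{\mathcal H}}\Big(\tfrac38V_h''(\xi^h_\star)\wedge\|V_h''\|_\infty\frac{V_h''(\xi^h_\star)^4}{4[V_h'']_{\mathrm{Lip}}^2}\Big),$$ where $[\cdot]_{\mathrm{Lip}}$ is the best Lipschitz constant. Call $(\beta,\gamma_1)$ admissible if $\beta\in(0,1]$, $\gamma_1>0$, and $\bar\lambda_1\gamma_1>1$ in case $\beta=1$; the learning rates are then $\gamma_n=\gamma_1n^{-\beta}$. The cost $\mathrm{Cost}_{\beta,\gamma_1}(\varepsilon)$ of an execution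 is the sum of the costs of its primitive operations (choosing the initial pair, drawing a sample of $Y$, drawing a sample of $Z$, evaluating $\varphi$, an arithmetic operation of the inner mean, an update of the pair), each of which has a fixed positive cost. Theorem. For $\varepsilon\in(0,1)$, run the algorithm with $h=h(\varepsilon)=1/\lceil\varepsilon^{-1}\rceil$ and $n=n_\beta(\varepsilon)=\lceil\varepsilon^{-2/\beta}\rceil$. (i) For every admissible $(\beta,\gamma_1)$ there is a constant $C$, independent of $\varepsilon$, such that for all $\varepsilon\in(0,1)$ the iterates are integrable and $$\mathbb E[|\xi^h_n-\xi^0_\star|]\le C\varepsilon,\qquad \mathbb E[|\chi^h_n-\chi^0_\star|]\le C\varepsilon .$$ (ii) For every admissible $(\beta,\gamma_1)$ there is a constant $C>0$, independent of $\varepsilon$, such that $\mathrm{Cost}_{\beta,\gamma_1}(\varepsilon)\le C\,n\,h^{-1}$ for all $\varepsilon\in(0,1)$, and $C\,n\,h^{-1}\sim C\varepsilon^{-2/\beta-1}$ as $\varepsilon\downarrow0$. (iii) The minimal cost is of order $\varepsilon^{-3}$ and is attained for $\beta=1$ under the restriction $\bar\lambda_1\gamma_1>1$. That is: there is $\gamma_1$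 with $(1,\gamma_1)$ admissible, and for every such $\gamma_1$ there are $c,C>0$ with $c\,\varepsilon^{-3}\le\mathrm{Cost}_{1,\gamma_1}(\varepsilon)\le C\varepsilon^{-3}$ for all $\varepsilon\in(0,1)$; moreover, for every admissible $(\beta,\gamma_1')$, $\mathrm{Cost}_{1,\gamma_1}(\varepsilon)\le\mathrm{Cost}_{\beta,\gamma_1'}(\varepsilon)$ for all $\varepsilon\in(0,1)$, and $\mathrm{Cost}_{1,\gamma_1}(\varepsilon)=\mathrm o(\mathrm{Cost}_{\beta,\gamma_1'}(\varepsilon))$ as $\varepsilon\downarrow0$ if $\beta<1$. -/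

import Mathlib

open MeasureTheory ProbabilityTheory Filter Topology Asymptotics

namespace NestedSA

noncomputable section

/-! ### Computations with a cost -/

/-- A computation together with the cost that it has accumulated. -/
structure Timed (A : Type) where
  val : A
  cost : ℝ

instance : Monad Timed where
  pure a := ⟨a, 0⟩
  bind m g := ⟨(g m.val).val, m.cost + (g m.val).cost⟩

/-- Charge the cost `c`. -/
def tick (c : ℝ) : Timed Unit := ⟨(), c⟩

/-- The (positive, otherwise arbitrary) costs of the primitive operations of the algorithm. -/
structure UnitCosts where
  /-- choosing the initial pair -/
  init : ℝ
  /-- drawing one sample of `Y` -/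
  drawY : ℝ
  /-- drawing one sample of `Z` -/
  drawZ : ℝ
  /-- one evaluation of `φ` -/
  eval : ℝ
  /-- one addition or division in the inner sample mean -/
  arith : ℝ
  /-- one update of the pair `(ξ, χ)`, the computation of the learning rate included -/
  update : ℝ
  init_pos : 0 < init
  drawY_pos : 0 < drawY
  drawZ_pos : 0 < drawZ
  eval_pos : 0 < eval
  arith_pos : 0 < arith
  update_pos : 0 < update

/-! ### The nested stochastic approximation algorithm -/

/-- `H₁(ξ, x) = 1 - 𝟙_{x ≥ ξ} / (1 - α)`. -/
def H1 (α ξ x : ℝ) : ℝ := 1 - (1 / (1 - α)) * (Set.Ici ξ).indicator (fun _ => (1 : ℝ)) x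

/-- `H₂(ξ, χ, x) = χ - (ξ + (x - ξ)⁺ / (1 - α))`. -/
def H2 (α ξ χ x : ℝ) : ℝ := χ - (ξ + (1 / (1 - α)) * max (x - ξ) 0)

/-- The learning rates `γ_n = γ₁ n ^ (-β)`, `n ≥ 1`. -/
def learningRate (γ₁ β : ℝ) (n : ℕ) : ℝ := γ₁ * (n : ℝ) ^ (-β)

variable {E F : Type}

/-- The inner loop: the sum of `φ (y, z)` over the drawn samples `z`. -/
def innerSum (u : UnitCosts) (φ : E × F → ℝ) (y : E) : List F → Timed ℝ
  | [] => pure 0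
  | z :: zs => do
      tick u.drawZ
      tick u.eval
      let s ← innerSum u φ y zs
      tick u.arith
      pure (φ (y, z) + s)

/-- One simulation of `X_h`, `h = 1 / K`, from a draw `y` of `Y` and `K` draws of `Z`. -/
def simulateLoss (u : UnitCosts) (φ : E × F → ℝ) (K : ℕ) (s : E × (Fin K → F)) : Timed ℝ := do
  tick u.drawY
  let t ← innerSum u φ s.1 (List.ofFn s.2)
  tick u.arith
  pure (t / (K : ℝ))

/-- The nested SA algorithm with bias parameter `h = 1 / K` and learning rates `γ`, started at
`init`; `s n` holds the samples drawn in the iteration that produces the iterate `n + 1`. -/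
def nestedSA (u : UnitCosts) (φ : E × F → ℝ) (α : ℝ) (γ : ℕ → ℝ) (K : ℕ)
    (init : ℝ × ℝ) (s : ℕ → E × (Fin K → F)) : ℕ → Timed (ℝ × ℝ)
  | 0 => do
      tick u.init
      pure init
  | n + 1 => do
      let p ← nestedSA u φ α γ K init s n
      let x ← simulateLoss u φ K (s n)
      tick u.update
      pure (p.1 - γ (n + 1) * H1 α p.1 x, p.2 - (1 / ((n : ℝ) + 1)) * H2 α p.1 p.2 x)

/-! ### The loss and its approximations

The bias parameters `h ∈ {1 / K : K ≥ 1} ∪ {0}` are indexed by `K : ℕ`: the index `K ≥ 1` stands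
for `h = 1 / K`, and the index `0` stands for `h = 0`. -/

/-- The bias parameter with index `K` (which is `0` for `K = 0`). -/
def bias (K : ℕ) : ℝ := (K : ℝ)⁻¹

/-- The law of `K` inner draws together with one outer draw: `Y` and `K` independent copies
of `Z`, independent of `Y`. -/
def sampleLaw {Ω : Type*} [MeasurableSpace Ω] [MeasurableSpace E] [MeasurableSpace F]
    (P : Measure Ω) (Y : Ω → E) (Z : Ω → F) (K : ℕ) : Measure (E × (Fin K → F)) :=
  (P.map Y).prod (Measure.pi fun _ => P.map Z)

/-- The law of the loss with index `K`: of `X₀ = 𝔼[φ(Y, Z) | Y]` for `K = 0`, and of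
`X_h = (1 / K) ∑_{k ≤ K} φ(Y, Z⁽ᵏ⁾)`, `h = 1 / K`, for `K ≥ 1`. -/
def lossLaw {Ω : Type*} [MeasurableSpace Ω] [MeasurableSpace E] [MeasurableSpace F]
    (P : Measure Ω) (Y : Ω → E) (Z : Ω → F) (φ : E × F → ℝ) : ℕ → Measure ℝ
  | 0 => P.map (P[fun ω => φ (Y ω, Z ω) | MeasurableSpace.comap Y inferInstance])
  | K + 1 => (sampleLaw P Y Z (K + 1)).map
      fun s => (1 / ((K + 1 : ℕ) : ℝ)) * ∑ k, φ (s.1, s.2 k)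

/-- `V(ξ) = ξ + 𝔼[(X - ξ)⁺] / (1 - α)` for a loss `X` with law `μ`. -/
def V (α : ℝ) (μ : Measure ℝ) (ξ : ℝ) : ℝ := ξ + (1 / (1 - α)) * ∫ x, max (x - ξ) 0 ∂μ

/-- The set `Θ` of the minimizers of `V`. -/
def argminV (α : ℝ) (μ : Measure ℝ) : Set ℝ := {ξ | ∀ ζ, V α μ ξ ≤ V α μ ζ}

/-- `f` is a continuous probability density of `μ`. -/
structure IsContinuousPdf (μ : Measure ℝ) (f : ℝ → ℝ) : Prop where
  continuous : Continuous f
  nonneg : ∀ x, 0 ≤ f x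
  eq_withDensity : μ = volume.withDensity fun x => ENNReal.ofReal (f x)

/-- First set of assumptions on the laws `μ K` of the losses, with densities `f K`:
first order expansion of the distribution functions in the bias parameter, and
existence, continuity and locally uniform convergence of the densities. -/
structure LossExpansion (α : ℝ) (μ : ℕ → Measure ℝ) (f : ℕ → ℝ → ℝ) : Prop where
  expansion : ∃ (v : ℝ → ℝ) (w : ℕ → ℝ → ℝ),
    (∀ K, 1 ≤ K → ∀ ξ, (μ K).real (Set.Iic ξ) - (μ 0).real (Set.Iic ξ)
      = v ξ * bias K + w K ξ * bias K) ∧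
    ∀ ξ₀ ∈ argminV α (μ 0),
      IntegrableOn v (Set.Ioi ξ₀) ∧
      (∀ K, 1 ≤ K → IntegrableOn (w K) (Set.Ioi ξ₀)) ∧
      Tendsto (fun K => w K ξ₀) atTop (𝓝 0) ∧
      Tendsto (fun K => ∫ ξ in Set.Ioi ξ₀, w K ξ) atTop (𝓝 0)
  pdf : ∀ K, IsContinuousPdf (μ K) (f K)
  pdf_tendsto : TendstoLocallyUniformly f (f 0) atTop

/-- Second set of assumptions: the densities are uniformly bounded away from `0` on each ball
around `ξ₀`, uniformly bounded, and uniformly Lipschitz. -/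
structure DensityBounds (f : ℕ → ℝ → ℝ) (ξ₀ : ℝ) : Prop where
  lower : ∀ R > 0, ∃ c > 0, ∀ K, ∀ ξ ∈ Metric.ball ξ₀ R, c ≤ f K ξ
  upper : ∃ M : ℝ, ∀ K x, |f K x| ≤ M
  lipschitz : ∃ L : NNReal, ∀ K, LipschitzWith L (f K)

/-- The supremum norm of a real function. -/
def supNorm (g : ℝ → ℝ) : ℝ := ⨆ x, |g x|

/-- The best Lipschitz constant of a real function. -/
def lipSeminorm (g : ℝ → ℝ) : ℝ := ⨆ p : ℝ × ℝ, |g p.1 - g p.2| / |p.1 - p.2|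

/-- The second derivative of `V`. -/
def V'' (α : ℝ) (μ : Measure ℝ) : ℝ → ℝ := deriv (deriv (V α μ))

/-- `(3/8) q V''(ξ) ∧ m V''(ξ)⁴ / (4 [V'']²_Lip)` with `m = q² ‖V''‖_∞`, where `ξ` is the
minimizer of `V`. -/
def lambdaBarOf (q : ℕ) (α : ℝ) (μ : Measure ℝ) (ξ : ℝ) : ℝ :=
  min (3 / 8 * (q : ℝ) * V'' α μ ξ)
    ((q : ℝ) ^ 2 * supNorm (V'' α μ) * (V'' α μ ξ ^ 4 / (4 * lipSeminorm (V'' α μ) ^ 2)))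

/-- The infimum of the previous constants over all bias parameters, `0` included. -/
def lambdaBar (q : ℕ) (α : ℝ) (μ : ℕ → Measure ℝ) (ξs : ℕ → ℝ) : ℝ :=
  ⨅ K : ℕ, lambdaBarOf q α (μ K) (ξs K)

/-- `k_α = 1 ∨ α / (1 - α)`. -/
def kα (α : ℝ) : ℝ := max 1 (α / (1 - α))

/-- The inputs of the algorithm for every `K ≥ 1`: independent samples with the right law and
a square integrable initial pair that is independent of them. -/
structure IsInput {Ω : Type*} [MeasurableSpace Ω] [MeasurableSpace E] [MeasurableSpace F]
    (P : Measure Ω) (Y : Ω → E) (Z : Ω → F)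
    (ξ0 χ0 : ℕ → Ω → ℝ) (S : (K : ℕ) → ℕ → Ω → E × (Fin K → F)) : Prop where
  measurable_ξ0 : ∀ K, 1 ≤ K → Measurable (ξ0 K)
  measurable_χ0 : ∀ K, 1 ≤ K → Measurable (χ0 K)
  memLp_ξ0 : ∀ K, 1 ≤ K → MemLp (ξ0 K) 2 P
  memLp_χ0 : ∀ K, 1 ≤ K → MemLp (χ0 K) 2 P
  measurable_S : ∀ K, 1 ≤ K → ∀ n, Measurable (S K n)
  map_S : ∀ K, 1 ≤ K → ∀ n, P.map (S K n) = sampleLaw P Y Z K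
  iIndepFun_S : ∀ K, 1 ≤ K → iIndepFun (S K) P
  indepFun_init : ∀ K, 1 ≤ K →
    IndepFun (fun ω => (ξ0 K ω, χ0 K ω)) (fun ω n => S K n ω) P

/-- The moment condition on the initial pairs, `f K` being the density of the loss with
index `K`. -/
structure InitialMoments {Ω : Type*} [MeasurableSpace Ω] (P : Measure Ω) (α : ℝ)
    (f : ℕ → ℝ → ℝ) (ξ0 χ0 : ℕ → Ω → ℝ) : Prop where
  exp_moment : ∃ M : ℝ, ∀ K, 1 ≤ K →
    Integrable (fun ω => |ξ0 K ω| ^ 2 *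
      Real.exp (4 / (1 - α) * kα α * (⨆ J : ℕ, supNorm (f J)) * |ξ0 K ω|)) P ∧
    ∫ ω, |ξ0 K ω| ^ 2 *
      Real.exp (4 / (1 - α) * kα α * (⨆ J : ℕ, supNorm (f J)) * |ξ0 K ω|) ∂P ≤ M
  moment : ∃ M : ℝ, ∀ K, 1 ≤ K → ∫ ω, |χ0 K ω| ∂P ≤ M

/-- The parameters `(β, γ₁)` of the learning rates allowed by the analysis, where `lam` is the
constant `lambdaBar 1`. -/
structure Admissible (lam β γ₁ : ℝ) : Prop where
  β_pos : 0 < β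
  β_le_one : β ≤ 1
  γ₁_pos : 0 < γ₁
  restriction : β = 1 → 1 < lam * γ₁

/-! ### The tuning for a prescribed accuracy -/

/-- The number of inner samples `⌈ε⁻¹⌉`; the bias parameter is `h = 1 / ⌈ε⁻¹⌉`. -/
def tunedK (ε : ℝ) : ℕ := ⌈ε⁻¹⌉₊

/-- The number of iterations `⌈ε ^ (-2/β)⌉`. -/
def tunedN (β ε : ℝ) : ℕ := ⌈ε ^ (-(2 / β))⌉₊

/-- The execution, on the random inputs at `ω`, of the algorithm tuned for the accuracy `ε`. -/
def tunedRun {Ω : Type*} (u : UnitCosts) (φ : E × F → ℝ) (α : ℝ)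
    (ξ0 χ0 : ℕ → Ω → ℝ) (S : (K : ℕ) → ℕ → Ω → E × (Fin K → F))
    (β γ₁ ε : ℝ) (ω : Ω) : Timed (ℝ × ℝ) :=
  nestedSA u φ α (learningRate γ₁ β) (tunedK ε)
    (ξ0 (tunedK ε) ω, χ0 (tunedK ε) ω) (fun n => S (tunedK ε) n ω) (tunedN β ε)

end

end NestedSA

namespace NestedSA

/-! ### Cost and values of an execution -/

section Execution

variable {E F : Type} (u : UnitCosts) (φ : E × F → ℝ)

/-! The error splits into a statistical part, the distance of the iterates from the minimizer and
the minimum of `V_h`, and a bias part, the distance of the latter from their values at `h = 0`. The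
tuning makes both of order `ε`.

Statistical part for `ξ`. `V_h'` is an affine function of the distribution function, hence monotone
and bounded, so a quadratic Lyapunov function would not contract linearly far from the minimizer.
The function `cosh (θ (ξ - ξ_h)) - 1` does: near the minimizer it is quadratic and `V_h'` is at
least linear; far away its logarithmic derivative is about `θ` and `V_h'` is bounded away from 0.
This is `drift`, with the rate `lambdaBarOf`. A second order expansion of `cosh` along one step
(`integral_cosh_step_le`) gives `W (n+1) ≤ (1 - λγ + Dγ²) W n + Dγ²`, and
`exists_bound_of_recursion` turns it into `W n = O(n^(-β))`; the condition `λγ₁ > 1` is what this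
needs for `β = 1`. Since `cosh x - 1 ≥ x²/2`, the mean square error is `O(n^(-β))`.

Statistical part for `χ`. It is an average with step `1/(n+1)`, whose mean square contracts at rate
`3/2 > β`; it is driven by noise of variance `O(1)` and by the error of `ξ`, which enters through
the Lipschitz function `V_h` (`integral_sq_step_le`, `exists_rate_snd`).

Bias. `F_h(ξ_h) = α = F_0(ξ_0)`, a first order expansion of `F_h` and a lower bound on the densities
give `ξ_h - ξ_0 = O(h)`. Writing `𝔼[(X - ξ)⁺]` as an integral of the tail and using that `V_h` is
Lipschitz gives the same order for the minima.

All constants are uniform in `h`: a single `θ`, a single `λ` (`lambdaBar_pos`) and a single moment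
bound serve every `K` (`exists_isModel`). With `n ≥ ε^(-2/β)` the mean square errors are `O(ε²)`.

The cost is deterministic, an affine function of `n` and `n K`, hence of order `ε^(-2/β - 1)`, whose
exponent is best at `β = 1`. -/

theorem Timed.val_bind {A B : Type} (m : Timed A) (g : A → Timed B) :
    (m >>= g).val = (g m.val).val := rfl

theorem Timed.cost_bind {A B : Type} (m : Timed A) (g : A → Timed B) :
    (m >>= g).cost = m.cost + (g m.val).cost := rfl

theorem Timed.val_pure {A : Type} (a : A) : (pure a : Timed A).val = a := rfl

theorem Timed.cost_pure {A : Type} (a : A) : (pure a : Timed A).cost = 0 := rfl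

theorem val_innerSum (y : E) (l : List F) :
    (innerSum u φ y l).val = (l.map fun z => φ (y, z)).sum := by
  induction l with
  | nil => rfl
  | cons z zs ih => simp [innerSum, Timed.val_bind, Timed.val_pure, ih]

theorem cost_innerSum (y : E) (l : List F) :
    (innerSum u φ y l).cost = l.length * (u.drawZ + u.eval + u.arith) := by
  induction l with
  | nil => simp [innerSum, Timed.cost_pure]
  | cons z zs ih =>
    simp only [innerSum, Timed.cost_bind, Timed.cost_pure, ih, tick, List.length_cons]
    push_cast
    ring

/-- The simulated loss as a function of the samples. -/
noncomputable def simLoss (K : ℕ) (s : E × (Fin K → F)) : ℝ :=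
  (1 / (K : ℝ)) * ∑ k, φ (s.1, s.2 k)

theorem val_simulateLoss (K : ℕ) (s : E × (Fin K → F)) :
    (simulateLoss u φ K s).val = simLoss φ K s := by
  simp only [simulateLoss, Timed.val_bind, Timed.val_pure, val_innerSum, simLoss, List.map_ofFn,
    List.sum_ofFn, Function.comp_apply]
  ring

theorem cost_simulateLoss (K : ℕ) (s : E × (Fin K → F)) :
    (simulateLoss u φ K s).cost
      = u.drawY + K * (u.drawZ + u.eval + u.arith) + u.arith := by
  simp only [simulateLoss, Timed.cost_bind, Timed.cost_pure, cost_innerSum, tick, List.length_ofFn]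
  ring

/-- The control flow never depends on the data, so the cost is free of `init` and of the samples;
comparisons of costs thereby become comparisons of real functions of `ε`. -/
theorem cost_nestedSA (α : ℝ) (γ : ℕ → ℝ) (K : ℕ) (init : ℝ × ℝ) (s : ℕ → E × (Fin K → F))
    (n : ℕ) :
    (nestedSA u φ α γ K init s n).cost
      = u.init + n * (u.drawY + K * (u.drawZ + u.eval + u.arith) + u.arith + u.update) := by
  induction n with
  | zero => simp [nestedSA, Timed.cost_bind, Timed.cost_pure, tick]
  | succ n ih =>
    simp only [nestedSA, Timed.cost_bind, Timed.cost_pure, cost_simulateLoss, tick, ih]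
    push_cast
    ring

/-- The stochastic approximation driven by the losses `x`. -/
noncomputable def saIter (α : ℝ) (γ : ℕ → ℝ) (p₀ : ℝ × ℝ) (x : ℕ → ℝ) : ℕ → ℝ × ℝ
  | 0 => p₀
  | n + 1 => ((saIter α γ p₀ x n).1 - γ (n + 1) * H1 α (saIter α γ p₀ x n).1 (x n),
      (saIter α γ p₀ x n).2
        - (1 / ((n : ℝ) + 1)) * H2 α (saIter α γ p₀ x n).1 (saIter α γ p₀ x n).2 (x n))

theorem val_nestedSA (α : ℝ) (γ : ℕ → ℝ) (K : ℕ) (init : ℝ × ℝ) (s : ℕ → E × (Fin K → F))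
    (n : ℕ) :
    (nestedSA u φ α γ K init s n).val = saIter α γ init (fun n => simLoss φ K (s n)) n := by
  induction n with
  | zero => rfl
  | succ n ih => simp only [nestedSA, Timed.val_bind, Timed.val_pure, val_simulateLoss, ih, saIter]

/-- The cost of an execution tuned for the accuracy `ε`. -/
noncomputable def tunedCost (β ε : ℝ) : ℝ :=
  u.init + tunedN β ε *
    (u.drawY + tunedK ε * (u.drawZ + u.eval + u.arith) + u.arith + u.update)

theorem cost_tunedRun {Ω : Type*} (α : ℝ) (ξ0 χ0 : ℕ → Ω → ℝ)
    (S : (K : ℕ) → ℕ → Ω → E × (Fin K → F)) (β γ₁ ε : ℝ) (ω : Ω) :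
    (tunedRun u φ α ξ0 χ0 S β γ₁ ε ω).cost = tunedCost u β ε :=
  cost_nestedSA ..

theorem inv_le_tunedK (ε : ℝ) : ε⁻¹ ≤ tunedK ε := Nat.le_ceil _

theorem rpow_le_tunedN (β ε : ℝ) : ε ^ (-(2 / β)) ≤ tunedN β ε := Nat.le_ceil _

theorem one_le_tunedK {ε : ℝ} (hε : 0 < ε) : 1 ≤ tunedK ε :=
  Nat.one_le_ceil_iff.2 (inv_pos.2 hε)

theorem one_le_tunedN (β : ℝ) {ε : ℝ} (hε : 0 < ε) : 1 ≤ tunedN β ε :=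
  Nat.one_le_ceil_iff.2 (Real.rpow_pos_of_pos hε _)

theorem bias_tunedK_le {ε : ℝ} (hε : 0 < ε) : bias (tunedK ε) ≤ ε :=
  inv_le_of_inv_le₀ hε (inv_le_tunedK ε)

/-- The sum of the unit costs. -/
noncomputable def UnitCosts.total : ℝ :=
  u.init + u.drawY + (u.drawZ + u.eval + u.arith) + u.arith + u.update

theorem UnitCosts.total_pos : 0 < u.total := by
  have := u.init_pos; have := u.drawY_pos; have := u.drawZ_pos; have := u.eval_pos
  have := u.arith_pos; have := u.update_pos
  unfold UnitCosts.total; positivity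

theorem tunedCost_le (β : ℝ) {ε : ℝ} (hε : 0 < ε) :
    tunedCost u β ε ≤ u.total * tunedN β ε * (bias (tunedK ε))⁻¹ := by
  have h1 := u.init_pos; have h2 := u.drawY_pos; have h3 := u.drawZ_pos; have h4 := u.eval_pos
  have h5 := u.arith_pos; have h6 := u.update_pos
  have hK : (1 : ℝ) ≤ tunedK ε := by exact_mod_cast one_le_tunedK hε
  have hN : (1 : ℝ) ≤ tunedN β ε := by exact_mod_cast one_le_tunedN β hε
  unfold tunedCost UnitCosts.total bias
  rw [inv_inv]
  generalize (tunedK ε : ℝ) = k at *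
  generalize (tunedN β ε : ℝ) = n at *
  have hnk : 1 ≤ n * k := by nlinarith
  have hnn : n ≤ n * k := by nlinarith
  calc _ = u.init * 1 + (u.drawY + u.arith + u.update) * n
        + (u.drawZ + u.eval + u.arith) * (n * k) := by ring
    _ ≤ u.init * (n * k) + (u.drawY + u.arith + u.update) * (n * k)
        + (u.drawZ + u.eval + u.arith) * (n * k) := by gcongr
    _ = _ := by ring

/-- Keeps only the `n K` draws of `Z`; the two ceilings only help. -/
theorem le_tunedCost (β : ℝ) {ε : ℝ} (hε : 0 < ε) :
    u.drawZ * ε ^ (-(2 / β) - 1) ≤ tunedCost u β ε := by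
  have h1 := u.init_pos; have h2 := u.drawY_pos; have h3 := u.drawZ_pos; have h4 := u.eval_pos
  have h5 := u.arith_pos; have h6 := u.update_pos
  rw [Real.rpow_sub_one hε.ne', div_eq_mul_inv]
  have hK := inv_le_tunedK ε
  have hN := rpow_le_tunedN β ε
  have hε' := inv_pos.2 hε
  have hp := Real.rpow_pos_of_pos hε (-(2 / β))
  have hp' := hp.trans_le hN
  have hk' := hε'.trans_le hK
  unfold tunedCost
  calc _ ≤ u.drawZ * (tunedN β ε * tunedK ε) := by gcongr
    _ ≤ _ := by
      have : 0 ≤ u.init + tunedN β ε * (u.drawY + tunedK ε * (u.eval + u.arith)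
        + u.arith + u.update) := by positivity
      linarith

theorem tunedCost_one_le {β ε : ℝ} (hβ : 0 < β) (hβ1 : β ≤ 1) (hε : 0 < ε) (hε1 : ε < 1) :
    tunedCost u 1 ε ≤ tunedCost u β ε := by
  have h1 := u.init_pos; have h2 := u.drawY_pos; have h3 := u.drawZ_pos; have h4 := u.eval_pos
  have h5 := u.arith_pos; have h6 := u.update_pos
  have hN : (tunedN 1 ε : ℝ) ≤ tunedN β ε := by
    refine Nat.cast_le.2 (Nat.ceil_mono ?_)
    apply Real.rpow_le_rpow_of_exponent_ge hε hε1.le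
    rw [neg_le_neg_iff]
    exact div_le_div_of_nonneg_left (by norm_num) hβ hβ1
  unfold tunedCost
  gcongr

theorem tunedCost_one_le_rpow {ε : ℝ} (hε : 0 < ε) (hε1 : ε < 1) :
    tunedCost u 1 ε ≤ 4 * u.total * ε ^ (-3 : ℝ) := by
  refine (tunedCost_le u 1 hε).trans ?_
  have hu := u.total_pos
  have hK : (tunedK ε : ℝ) ≤ 2 * ε⁻¹ := by
    have := (Nat.ceil_lt_add_one (inv_pos.2 hε).le).le
    have h1 : 1 ≤ ε⁻¹ := (one_le_inv₀ hε).2 hε1.le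
    unfold tunedK; linarith
  have hN : (tunedN 1 ε : ℝ) ≤ 2 * ε ^ (-2 : ℝ) := by
    have h0 := Real.rpow_pos_of_pos hε (-(2 / 1))
    have := (Nat.ceil_lt_add_one h0.le).le
    have h1 : 1 ≤ ε ^ (-(2 / 1) : ℝ) :=
      Real.one_le_rpow_of_pos_of_le_one_of_nonpos hε hε1.le (by norm_num)
    have h2 : ε ^ (-2 : ℝ) = ε ^ (-(2 / 1) : ℝ) := by norm_num
    unfold tunedN; rw [h2]; linarith
  have h3 : ε ^ (-3 : ℝ) = ε ^ (-2 : ℝ) * ε⁻¹ := by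
    rw [show (-3 : ℝ) = -2 - 1 by norm_num, Real.rpow_sub_one hε.ne', div_eq_mul_inv]
  have hp := Real.rpow_pos_of_pos hε (-2)
  have hp' := inv_pos.2 hε
  unfold bias
  rw [inv_inv, h3]
  calc _ ≤ u.total * (2 * ε ^ (-2 : ℝ)) * (2 * ε⁻¹) := by gcongr
    _ = _ := by ring

/-- The upper bound at `1` and the lower bound at `β` have a ratio of order `ε ^ (2/β - 2)`, with a
positive exponent when `β < 1`. -/
theorem tunedCost_isLittleO {β : ℝ} (hβ : 0 < β) (hβ1 : β < 1) {δ : ℝ} (hδ : 0 < δ) :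
    ∀ᶠ ε in 𝓝[>] (0 : ℝ), tunedCost u 1 ε ≤ δ * tunedCost u β ε := by
  have hu := u.total_pos
  have hz := u.drawZ_pos
  have hexp : 0 < 2 / β - 2 := by
    rw [sub_pos, lt_div_iff₀ hβ]; linarith
  have ht : Tendsto (fun ε : ℝ => ε ^ (2 / β - 2)) (𝓝[>] 0) (𝓝 0) := by
    have := (Real.continuousAt_rpow_const 0 (2 / β - 2) (Or.inr hexp.le)).tendsto
    rw [Real.zero_rpow hexp.ne'] at this
    exact this.mono_left nhdsWithin_le_nhds
  have hev := ht.eventually_lt_const (show 0 < δ * u.drawZ / (4 * u.total) by positivity)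
  filter_upwards [hev, self_mem_nhdsWithin, Ioo_mem_nhdsGT (zero_lt_one (α := ℝ))]
    with ε h1 hε hε1
  refine (tunedCost_one_le_rpow u hε hε1.2).trans
    (le_trans ?_ (mul_le_mul_of_nonneg_left (le_tunedCost u β hε) hδ.le))
  have hsplit : ε ^ (-3 : ℝ) = ε ^ (2 / β - 2) * ε ^ (-(2 / β) - 1) := by
    rw [← Real.rpow_add hε]; ring_nf
  rw [lt_div_iff₀ (by positivity)] at h1
  have hp := Real.rpow_pos_of_pos hε (-(2 / β) - 1)
  rw [hsplit]
  calc _ = ε ^ (2 / β - 2) * (4 * u.total) * ε ^ (-(2 / β) - 1) := by ring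
    _ ≤ δ * u.drawZ * ε ^ (-(2 / β) - 1) := by gcongr
    _ = _ := by ring

theorem tunedN_mul_tunedK_isEquivalent {β : ℝ} (hβ : 0 < β) (C : ℝ) :
    (fun ε : ℝ => C * (tunedN β ε : ℝ) * (bias (tunedK ε))⁻¹)
      ~[𝓝[>] 0] fun ε : ℝ => C * ε ^ (-(2 / β) - 1) := by
  have hinv : Tendsto (fun ε : ℝ => ε⁻¹) (𝓝[>] 0) atTop := tendsto_inv_nhdsGT_zero
  have hpow : Tendsto (fun ε : ℝ => ε ^ (-(2 / β))) (𝓝[>] 0) atTop := by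
    refine ((tendsto_rpow_atTop (show 0 < 2 / β by positivity)).comp hinv).congr' ?_
    filter_upwards [self_mem_nhdsWithin] with ε hε
    rw [Function.comp_apply, Real.inv_rpow (le_of_lt hε), Real.rpow_neg (le_of_lt hε)]
  have hceil : (fun x : ℝ => (⌈x⌉₊ : ℝ)) ~[atTop] fun x => x := by
    refine (isEquivalent_iff_tendsto_one ?_).2 ?_
    · filter_upwards [eventually_gt_atTop 0] with x hx using hx.ne'
    · exact tendsto_nat_ceil_div_atTop (R := ℝ)
  have h1 := hceil.comp_tendsto hinv
  have h2 := hceil.comp_tendsto hpow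
  have h3 := ((IsEquivalent.refl (u := fun _ : ℝ => C)).mul h2).mul h1
  refine (h3.congr_left ?_).congr_right ?_
  · exact Eventually.of_forall fun ε => by
      simp [tunedN, tunedK, bias]
  · filter_upwards [self_mem_nhdsWithin] with ε hε
    change C * ε ^ (-(2 / β)) * ε⁻¹ = _
    rw [Real.rpow_sub_one (ne_of_gt hε), ← mul_div_assoc, ← div_eq_mul_inv]

end Execution

/-! ### A recursive inequality -/

section Recursion

/-- The target `(n + 1)^(-β)` itself decays at the relative rate `β / (n + 1)`; the contraction must
beat it with room to spare. For `b < 1` any `lam'` works because `n aₙ → ∞`; for `b = 1` the choice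
`β / a₁` gives equality, and it is below `lam` exactly under the stated restriction. -/
theorem eventually_rpow_ratio_le {a₁ lam b β : ℝ} (ha : 0 < a₁)
    (hlam : 0 < lam) (hβ : 0 < β) (hb : b < 1 ∨ b = 1 ∧ β < lam * a₁) :
    ∃ lam' < lam, 0 < lam' ∧
      ∀ᶠ n : ℕ in atTop, β / ((n : ℝ) + 1) ≤ lam' * (a₁ * ((n : ℝ) + 1) ^ (-b)) := by
  rcases hb with hb | ⟨rfl, hb⟩
  · refine ⟨lam / 2, by linarith, by linarith, ?_⟩
    have h1 : Tendsto (fun n : ℕ => ((n : ℝ) + 1)) atTop atTop :=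
      tendsto_atTop_add_const_right _ _ tendsto_natCast_atTop_atTop
    have h2 := (tendsto_rpow_atTop (show 0 < 1 - b by linarith)).comp h1
    filter_upwards [h2.eventually_ge_atTop (β / (lam / 2 * a₁))] with n hn
    have hn0 : (0 : ℝ) < (n : ℝ) + 1 := by positivity
    rw [Function.comp_apply, div_le_iff₀ (by positivity), sub_eq_add_neg,
      Real.rpow_add hn0, Real.rpow_one] at hn
    rw [div_le_iff₀ hn0]
    linarith
  · refine ⟨β / a₁, by rwa [div_lt_iff₀ ha], by positivity, Eventually.of_forall fun n => ?_⟩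
    have hn0 : (0 : ℝ) < (n : ℝ) + 1 := by positivity
    rw [Real.rpow_neg_one]
    apply le_of_eq
    field_simp

/-- Bernoulli's inequality for an exponent at most 1. -/
theorem rpow_neg_le_mul_succ {β : ℝ} (hβ : 0 < β) (hβ1 : β ≤ 1) (n : ℕ) :
    ((n : ℝ) + 1) ^ (-β)
      ≤ (1 + β / ((n : ℝ) + 1)) * (((n + 1 : ℕ) : ℝ) + 1) ^ (-β) := by
  have hn0 : (0 : ℝ) < (n : ℝ) + 1 := by positivity
  have hn1 : (0 : ℝ) < ((n + 1 : ℕ) : ℝ) + 1 := by positivity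
  have h1 : (((n + 1 : ℕ) : ℝ) + 1) = (1 + 1 / ((n : ℝ) + 1)) * ((n : ℝ) + 1) := by
    push_cast; field_simp
  have h2 : (1 + 1 / ((n : ℝ) + 1)) ^ β ≤ 1 + β * (1 / ((n : ℝ) + 1)) :=
    rpow_one_add_le_one_add_mul_self (by
      have : 0 ≤ 1 / ((n : ℝ) + 1) := by positivity
      linarith) hβ.le hβ1
  have hpos : 0 < 1 + 1 / ((n : ℝ) + 1) := by positivity
  rw [h1, Real.mul_rpow hpos.le hn0.le, Real.rpow_neg hpos.le]
  have h3 : 1 ≤ (1 + β / ((n : ℝ) + 1)) * ((1 + 1 / ((n : ℝ) + 1)) ^ β)⁻¹ := by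
    rw [← div_eq_mul_inv, one_le_div (by positivity)]
    calc _ ≤ _ := h2
      _ = _ := by ring
  rw [← mul_assoc]
  exact le_mul_of_one_le_left (by positivity) h3

/-- Sequences with `b (n + 1) ≤ (1 - λ aₙ + C aₙ²) b n + C aₙ ρₙ`, where `aₙ = a₁ (n + 1)⁻ᵇ` and
`ρₙ = (n + 1)^(-β)`, are `O(ρ)`, uniformly in such sequences with a given bound on `b 0`. -/
theorem exists_bound_of_recursion {a₁ lam b β : ℝ} (ha : 0 < a₁) (hb0 : 0 < b) (hlam : 0 < lam)
    (hβ : 0 < β) (hβ1 : β ≤ 1) (hb : b < 1 ∨ b = 1 ∧ β < lam * a₁) (C B : ℝ) (hC : 0 ≤ C)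
    (hB : 0 ≤ B) :
    ∃ C', 0 ≤ C' ∧ ∀ x : ℕ → ℝ, (∀ n, 0 ≤ x n) → x 0 ≤ B →
      (∀ n : ℕ, x (n + 1) ≤ (1 - lam * (a₁ * ((n : ℝ) + 1) ^ (-b))
          + C * (a₁ * ((n : ℝ) + 1) ^ (-b)) ^ 2) * x n
        + C * (a₁ * ((n : ℝ) + 1) ^ (-b)) * ((n : ℝ) + 1) ^ (-β)) →
      ∀ n : ℕ, x n ≤ C' * ((n : ℝ) + 1) ^ (-β) := by
  set a : ℕ → ℝ := fun n => a₁ * ((n : ℝ) + 1) ^ (-b) with ha_def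
  set ρ : ℕ → ℝ := fun n => ((n : ℝ) + 1) ^ (-β) with hρ_def
  have hn0 : ∀ n : ℕ, (0 : ℝ) < (n : ℝ) + 1 := fun n => by positivity
  have ha0 : ∀ n, 0 < a n := fun n => mul_pos ha (Real.rpow_pos_of_pos (hn0 n) _)
  have hρ0 : ∀ n, 0 < ρ n := fun n => Real.rpow_pos_of_pos (hn0 n) _
  -- the comparison sequence
  let c : ℕ → ℝ := fun n => max 0 (1 - lam * a n + C * a n ^ 2)
  let y : ℕ → ℝ := fun n => Nat.rec B (fun n r => c n * r + C * a n * ρ n) n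
  have hy_succ : ∀ n, y (n + 1) = c n * y n + C * a n * ρ n := fun n => rfl
  have hy0 : ∀ n, 0 ≤ y n := by
    intro n
    induction n with
    | zero => exact hB
    | succ n ih =>
      rw [hy_succ]
      have := ha0 n; have := hρ0 n
      have : 0 ≤ c n := le_max_left _ _
      positivity
  -- The factor `c` is clipped at 0, so `y` dominates every admissible `x` by induction. The
  -- constant is then read off the single sequence `y`, which gives uniformity.
  have hcomp : ∀ x : ℕ → ℝ, (∀ n, 0 ≤ x n) → x 0 ≤ B →
      (∀ n, x (n + 1) ≤ (1 - lam * a n + C * a n ^ 2) * x n + C * a n * ρ n) →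
      ∀ n, x n ≤ y n := by
    intro x hx hx0 hrec n
    induction n with
    | zero => exact hx0
    | succ n ih =>
      refine (hrec n).trans ?_
      rw [hy_succ]
      refine add_le_add ?_ le_rfl
      calc _ ≤ c n * x n := mul_le_mul_of_nonneg_right (le_max_right _ _) (hx n)
        _ ≤ _ := mul_le_mul_of_nonneg_left ih (le_max_left _ _)
  have hat : Tendsto a atTop (𝓝 0) := by
    have h1 : Tendsto (fun n : ℕ => ((n : ℝ) + 1)) atTop atTop :=
      tendsto_atTop_add_const_right _ _ tendsto_natCast_atTop_atTop
    simpa using ((tendsto_rpow_neg_atTop hb0).comp h1).const_mul a₁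
  obtain ⟨lam', hlam', hlam'0, hratio⟩ := eventually_rpow_ratio_le ha hlam hβ hb
  -- Half of the gap absorbs the quadratic term `C aₙ²`, the other half absorbs the forcing term.
  set η := (lam - lam') / 2 with hη
  have hη0 : 0 < η := by rw [hη]; linarith
  have hev1 : ∀ᶠ n in atTop, C * a n ≤ η := by
    have := hat.const_mul C
    rw [mul_zero] at this
    exact (this.eventually_lt_const hη0).mono fun n h => h.le
  have hev2 : ∀ᶠ n in atTop, lam * a n ≤ 1 := by
    have := hat.const_mul lam
    rw [mul_zero] at this
    exact (this.eventually_lt_const one_pos).mono fun n h => h.le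
  obtain ⟨N, hN⟩ := eventually_atTop.1 (hratio.and (hev1.and hev2))
  -- The first entry makes the inductive step close beyond `N`; the sum covers the finitely many
  -- indices up to `N`.
  set D := max (C * (1 + β) / η) (∑ i ∈ Finset.range (N + 1), y i / ρ i) with hD
  have hD0 : 0 ≤ D := le_max_of_le_left (by positivity)
  have hbase : ∀ i ≤ N, y i ≤ D * ρ i := by
    intro i hi
    rw [← div_le_iff₀ (hρ0 i)]
    refine le_max_of_le_right ?_
    exact Finset.single_le_sum (f := fun i => y i / ρ i)
      (fun j _ => div_nonneg (hy0 j) (hρ0 j).le) (Finset.mem_range.2 (by omega))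
  have hmain : ∀ n, y n ≤ D * ρ n := by
    intro n
    rcases le_total n N with h | h
    · exact hbase n h
    · induction n, h using Nat.le_induction with
      | base => exact hbase N le_rfl
      | succ n hn ih =>
        obtain ⟨h1, h2, h3⟩ := hN n hn
        have han := ha0 n
        have hρn := hρ0 n
        have hρs := hρ0 (n + 1)
        have hc : c n ≤ 1 - (lam' + η) * a n := by
          have h4 : C * a n ^ 2 ≤ η * a n := by
            rw [sq, ← mul_assoc]; exact mul_le_mul_of_nonneg_right h2 han.le
          have h5 : lam' + 2 * η = lam := by rw [hη]; ring
          refine max_le ?_ ?_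
          · have : (lam' + η) * a n ≤ lam * a n := by gcongr; linarith
            linarith
          · rw [← h5]; linarith
        have hc0 : 0 ≤ c n := le_max_left _ _
        have hρr : ρ n ≤ (1 + β / ((n : ℝ) + 1)) * ρ (n + 1) := rpow_neg_le_mul_succ hβ hβ1 n
        have hρr' : ρ n ≤ (1 + β) * ρ (n + 1) := by
          refine hρr.trans ?_
          gcongr
          exact div_le_self hβ.le (by linarith [Nat.cast_nonneg (α := ℝ) n])
        have hCD : C * (1 + β) ≤ D * η := by
          rw [← div_le_iff₀ hη0]; exact le_max_left _ _
        rw [hy_succ]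
        -- Passing from `ρ n` to `ρ (n + 1)` costs `β / (n + 1) ≤ lam' * a n`, so a contraction of
        -- `η * a n` survives.
        have hratio' : (1 - (lam' + η) * a n) * (1 + β / ((n : ℝ) + 1)) ≤ 1 - η * a n := by
          have h6 : 0 ≤ (lam' + η) * a n * (β / ((n : ℝ) + 1)) := by positivity
          linarith
        have h1c : 0 ≤ 1 - (lam' + η) * a n := hc0.trans hc
        calc c n * y n + C * a n * ρ n
            ≤ (1 - (lam' + η) * a n) * (D * ((1 + β / ((n : ℝ) + 1)) * ρ (n + 1)))
              + C * a n * ((1 + β) * ρ (n + 1)) := by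
              have h7 := mul_le_mul hc (ih.trans (mul_le_mul_of_nonneg_left hρr hD0)) (hy0 n) h1c
              gcongr
          _ = D * ((1 - (lam' + η) * a n) * (1 + β / ((n : ℝ) + 1))) * ρ (n + 1)
              + (C * (1 + β)) * a n * ρ (n + 1) := by ring
          _ ≤ D * (1 - η * a n) * ρ (n + 1) + (D * η) * a n * ρ (n + 1) := by gcongr
          _ = D * ρ (n + 1) := by ring
  exact ⟨D, hD0, fun x hx hx0 hrec n => (hcomp x hx hx0 hrec n).trans (hmain n)⟩

end Recursion

/-! ### The drift of the exponential Lyapunov function -/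

section Drift

/-- Adding `e^u (1 - u) ≤ 1` and `e^(-u) (1 + u) ≤ 1` gives the claim. -/
theorem cosh_sub_one_le_mul_sinh (u : ℝ) : Real.cosh u - 1 ≤ u * Real.sinh u := by
  have h1 : 1 - u ≤ Real.exp (-u) := by have := Real.add_one_le_exp (-u); linarith
  have h2 : 1 + u ≤ Real.exp u := by have := Real.add_one_le_exp u; linarith
  have h3 : Real.exp u * Real.exp (-u) = 1 := by rw [← Real.exp_add]; simp
  have h4 := mul_le_mul_of_nonneg_left h1 (Real.exp_pos u).le
  have h5 := mul_le_mul_of_nonneg_left h2 (Real.exp_pos (-u)).le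
  rw [Real.cosh_eq, Real.sinh_eq]
  nlinarith

theorem cosh_sub_one_le_sinh {u : ℝ} (hu : 0 ≤ u) : Real.cosh u - 1 ≤ Real.sinh u := by
  have := Real.cosh_sub_sinh u
  have h : Real.exp (-u) ≤ 1 := Real.exp_le_one_iff.2 (by linarith)
  linarith

theorem quadratic_le_of_hasDerivAt {g g' : ℝ → ℝ} {m l : ℝ} (hg : ∀ x, HasDerivAt g (g' x) x)
    (h0 : g 0 = 0) (hlip : ∀ x, 0 ≤ x → m - l * x ≤ g' x) {x : ℝ} (hx : 0 ≤ x) :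
    m * x - l * x ^ 2 / 2 ≤ g x := by
  have hd : ∀ y, HasDerivAt (fun y => g y - (m * y - l * y ^ 2 / 2)) (g' y - (m - l * y)) y := by
    intro y
    have h1 := ((hasDerivAt_id y).const_mul m).sub
      ((((hasDerivAt_id y).pow 2).const_mul l).div_const 2)
    exact ((hg y).sub h1).congr_deriv (by simp; ring)
  have hmono : MonotoneOn (fun y => g y - (m * y - l * y ^ 2 / 2)) (Set.Ici 0) := by
    refine monotoneOn_of_hasDerivWithinAt_nonneg (convex_Ici 0)
      (fun y _ => (hd y).continuousAt.continuousWithinAt)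
      (fun y _ => (hd y).hasDerivWithinAt) fun y hy => ?_
    rw [interior_Ici] at hy
    have := hlip y (le_of_lt hy)
    linarith
  have := hmono (Set.mem_Ici.2 le_rfl) (Set.mem_Ici.2 hx) hx
  simp only [h0] at this
  linarith

theorem sq_div_le_of_hasDerivAt {g g' : ℝ → ℝ} {m l : ℝ} (hg : ∀ x, HasDerivAt g (g' x) x)
    (h0 : g 0 = 0) (hm : 0 < m) (hl : 0 < l) (hlip : ∀ x, 0 ≤ x → m - l * x ≤ g' x) :
    m ^ 2 / (2 * l) ≤ g (m / l) := by
  have := quadratic_le_of_hasDerivAt hg h0 hlip (x := m / l) (by positivity)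
  calc _ = m * (m / l) - l * (m / l) ^ 2 / 2 := by field_simp; ring
    _ ≤ _ := this

/-- The two regimes meet at `m / l`, the vertex of the parabola `m x - l x² / 2` below `g`. Before
it, `g x ≥ m x / 2` yields the rate `m / 2`. Beyond it, monotonicity keeps `g` above `m² / (2l)`,
which yields the rate `θ m² / (2l)`; as `m² / (2l) ≤ 1`, this is at least `M m⁴ / (4 l²)`. -/
theorem drift_of_nonneg {g g' : ℝ → ℝ} {m l M θ lam : ℝ} (hg : ∀ x, HasDerivAt g (g' x) x)
    (h0 : g 0 = 0) (hm : 0 < m) (hl : 0 < l) (hlip : ∀ x, 0 ≤ x → m - l * x ≤ g' x)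
    (hmono : Monotone g) (hml : m ^ 2 ≤ 2 * l) (hM : 0 ≤ M) (hθ : M ≤ θ)
    (hlam : lam ≤ 3 / 8 * m) (hlam' : lam ≤ M * (m ^ 4 / (4 * l ^ 2))) {x : ℝ} (hx : 0 ≤ x) :
    lam * (Real.cosh (θ * x) - 1) ≤ θ * g x * Real.sinh (θ * x) := by
  have hθ0 : 0 ≤ θ := hM.trans hθ
  have hc : 0 ≤ Real.cosh (θ * x) - 1 := by linarith [Real.one_le_cosh (θ * x)]
  have hs : 0 ≤ Real.sinh (θ * x) := Real.sinh_nonneg_iff.2 (by positivity)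
  rcases le_total x (m / l) with h | h
  · have h1 := quadratic_le_of_hasDerivAt hg h0 hlip hx
    have h2 : l * x ≤ m := by rw [le_div_iff₀ hl] at h; linarith
    have h3 : m * x / 2 ≤ g x := by nlinarith
    calc _ ≤ (m / 2) * (Real.cosh (θ * x) - 1) :=
          mul_le_mul_of_nonneg_right (by linarith) hc
      _ ≤ (m / 2) * (θ * x * Real.sinh (θ * x)) := by
          gcongr; exact cosh_sub_one_le_mul_sinh _
      _ = θ * (m * x / 2) * Real.sinh (θ * x) := by ring
      _ ≤ _ := by gcongr
  · have h1 : m ^ 2 / (2 * l) ≤ g x :=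
      (sq_div_le_of_hasDerivAt hg h0 hm hl hlip).trans (hmono h)
    have h2 : lam ≤ θ * g x := by
      calc lam ≤ M * (m ^ 4 / (4 * l ^ 2)) := hlam'
        _ = M * (m ^ 2 / (2 * l) * (m ^ 2 / (2 * l))) := by field_simp; ring
        _ ≤ M * (m ^ 2 / (2 * l) * 1) := by
          gcongr
          exact (div_le_one (by positivity)).2 hml
        _ ≤ θ * (g x * 1) := by gcongr
        _ = θ * g x := by ring
    exact mul_le_mul h2 (cosh_sub_one_le_sinh (by positivity)) hc
      (mul_nonneg hθ0 ((by positivity : 0 ≤ m ^ 2 / (2 * l)).trans h1))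

theorem drift {g g' : ℝ → ℝ} {m l M θ lam : ℝ} (hg : ∀ x, HasDerivAt g (g' x) x)
    (h0 : g 0 = 0) (hm : 0 < m) (hl : 0 < l) (hlip : ∀ x, |g' x - m| ≤ l * |x|)
    (hmono : Monotone g) (hg1 : ∀ x, g x ≤ 1) (hM : 0 ≤ M) (hθ : M ≤ θ)
    (hlam : lam ≤ 3 / 8 * m) (hlam' : lam ≤ M * (m ^ 4 / (4 * l ^ 2))) (x : ℝ) :
    lam * (Real.cosh (θ * x) - 1) ≤ θ * g x * Real.sinh (θ * x) := by
  have hlip1 : ∀ x, 0 ≤ x → m - l * x ≤ g' x := fun x hx => by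
    have h1 := neg_le_of_abs_le (hlip x)
    rw [abs_of_nonneg hx] at h1; linarith
  have hlip2 : ∀ x, 0 ≤ x → m - l * x ≤ g' (-x) := fun x hx => by
    have h1 := neg_le_of_abs_le (hlip (-x))
    rw [abs_neg, abs_of_nonneg hx] at h1; linarith
  -- This is the value at the vertex compared with `g ≤ 1`. It is derived before the reflection `x ↦
  -- -g (-x)` used for negative `x`, since that function is not assumed to be at most 1.
  have hml : m ^ 2 ≤ 2 * l := by
    have := (sq_div_le_of_hasDerivAt hg h0 hm hl hlip1).trans (hg1 _)
    rwa [div_le_one (by positivity)] at this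
  rcases le_total 0 x with hx | hx
  · exact drift_of_nonneg hg h0 hm hl hlip1 hmono hml hM hθ hlam hlam' hx
  · have hneg : ∀ x, HasDerivAt (fun y => -g (-y)) (g' (-x)) x := fun x => by
      have := ((hg (-x)).comp x (hasDerivAt_neg x)).neg
      exact this.congr_deriv (by ring)
    have := drift_of_nonneg hneg (by simp [h0]) hm hl hlip2
      (fun a b hab => neg_le_neg (hmono (neg_le_neg hab))) hml hM hθ hlam hlam'
      (x := -x) (by linarith)
    simpa using this

end Drift

/-! ### The functions `V` -/

section Loss

variable {α : ℝ} {μ : Measure ℝ} {f : ℝ → ℝ}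

theorem IsContinuousPdf.integrable [IsProbabilityMeasure μ] (hf : IsContinuousPdf μ f) :
    Integrable f := by
  refine ⟨hf.continuous.aestronglyMeasurable, ?_⟩
  have h : μ Set.univ = 1 := measure_univ
  rw [hf.eq_withDensity, withDensity_apply _ MeasurableSet.univ, setLIntegral_univ] at h
  rw [hasFiniteIntegral_iff_ofReal (Eventually.of_forall hf.nonneg), h]
  exact ENNReal.one_lt_top

theorem IsContinuousPdf.nullSingletonClass (hf : IsContinuousPdf μ f) : NullSingletonClass μ := by
  rw [hf.eq_withDensity]; infer_instance

theorem IsContinuousPdf.measureReal_Iic [IsProbabilityMeasure μ] (hf : IsContinuousPdf μ f)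
    (b : ℝ) : μ.real (Set.Iic b) = ∫ x in Set.Iic b, f x := by
  rw [integral_eq_lintegral_of_nonneg_ae (Eventually.of_forall hf.nonneg)
    hf.continuous.aestronglyMeasurable, measureReal_def]
  nth_rw 1 [hf.eq_withDensity]
  rw [withDensity_apply _ measurableSet_Iic]

theorem IsContinuousPdf.measureReal_Iic_sub [IsProbabilityMeasure μ] (hf : IsContinuousPdf μ f)
    (a b : ℝ) : μ.real (Set.Iic b) - μ.real (Set.Iic a) = ∫ x in a..b, f x := by
  rw [hf.measureReal_Iic, hf.measureReal_Iic,
    intervalIntegral.integral_Iic_sub_Iic hf.integrable.integrableOn hf.integrable.integrableOn]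

theorem IsContinuousPdf.hasDerivAt_Iic [IsProbabilityMeasure μ] (hf : IsContinuousPdf μ f)
    (x : ℝ) : HasDerivAt (fun b => μ.real (Set.Iic b)) (f x) x := by
  have h := intervalIntegral.integral_hasDerivAt_right (a := 0) (b := x)
    (hf.continuous.intervalIntegrable _ _) (hf.continuous.stronglyMeasurableAtFilter _ _)
    hf.continuous.continuousAt
  have h2 := h.add_const (μ.real (Set.Iic 0))
  refine h2.congr_of_eventuallyEq (Eventually.of_forall fun b => ?_)
  change μ.real (Set.Iic b) = (∫ x in (0 : ℝ)..b, f x) + μ.real (Set.Iic 0)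
  rw [← hf.measureReal_Iic_sub 0 b]; ring

/-- The derivative of `V`. -/
noncomputable def gradV (α : ℝ) (μ : Measure ℝ) (ξ : ℝ) : ℝ :=
  (1 / (1 - α)) * (μ.real (Set.Iic ξ) - α)

theorem measureReal_Ioi [IsProbabilityMeasure μ] (ξ : ℝ) :
    μ.real (Set.Ioi ξ) = 1 - μ.real (Set.Iic ξ) := by
  rw [← Set.compl_Iic, measureReal_compl measurableSet_Iic]; simp

theorem integrable_max_sub [IsFiniteMeasure μ] (hμ : Integrable id μ) (ξ : ℝ) :
    Integrable (fun x => max (x - ξ) 0) μ :=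
  (hμ.sub (integrable_const ξ)).pos_part

/-- Differentiation under the integral: `(x - ξ)⁺` is 1-Lipschitz in `ξ` and has the derivative
`-𝟙_{x > ξ}` except at `x = ξ`, a null event because `μ` has no atoms. -/
theorem hasDerivAt_V [IsProbabilityMeasure μ] [NullSingletonClass μ] (hα : α < 1) (hμ : Integrable id μ)
    (ξ : ℝ) : HasDerivAt (V α μ) (gradV α μ ξ) ξ := by
  have h := hasDerivAt_integral_of_dominated_loc_of_lip (μ := μ) (𝕜 := ℝ)
    (F := fun ξ x => max (x - ξ) 0) (F' := (Set.Ioi ξ).indicator fun _ => (-1 : ℝ))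
    (x₀ := ξ) (s := Set.univ) (bound := fun _ => 1) univ_mem
    (Eventually.of_forall fun ξ => (integrable_max_sub hμ ξ).aestronglyMeasurable)
    (integrable_max_sub hμ ξ)
    (measurable_const.indicator measurableSet_Ioi).aestronglyMeasurable
    (Eventually.of_forall fun x => ?_) (integrable_const _) ?_
  · have h2 := (hasDerivAt_id ξ).add (h.2.const_mul (1 / (1 - α)))
    refine h2.congr_deriv ?_
    rw [integral_indicator measurableSet_Ioi, setIntegral_const, measureReal_Ioi, gradV]
    have : 1 - α ≠ 0 := by linarith
    simp only [smul_eq_mul]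
    field_simp
    ring
  · refine LipschitzOnWith.of_dist_le_mul fun a _ b _ => ?_
    simp only [Real.dist_eq, map_one, NNReal.coe_one, one_mul]
    refine (abs_max_sub_max_le_abs _ _ _).trans (le_of_eq ?_)
    rw [abs_sub_comm]; congr 1; ring
  · filter_upwards [compl_mem_ae_iff.2 (measure_singleton (μ := μ) ξ)] with x hx
    have hx' : x ≠ ξ := hx
    rcases lt_or_gt_of_ne hx' with h | h
    · rw [Set.indicator_of_notMem (by simpa using h.le)]
      refine (hasDerivAt_const ξ (0 : ℝ)).congr_of_eventuallyEq ?_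
      filter_upwards [Ioi_mem_nhds h] with y hy
      exact max_eq_right (by have : x < y := hy; linarith)
    · rw [Set.indicator_of_mem (show x ∈ Set.Ioi ξ from h)]
      refine ((hasDerivAt_id ξ).const_sub x).congr_of_eventuallyEq ?_
      filter_upwards [Iio_mem_nhds h] with y hy
      exact max_eq_left (by have : y < x := hy; linarith)

theorem IsContinuousPdf.V''_eq [IsProbabilityMeasure μ] (hf : IsContinuousPdf μ f) (hα : α < 1)
    (hμ : Integrable id μ) : V'' α μ = fun ξ => (1 / (1 - α)) * f ξ := by
  have := hf.nullSingletonClass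
  have h1 : deriv (V α μ) = gradV α μ := funext fun ξ => (hasDerivAt_V hα hμ ξ).deriv
  funext ξ
  rw [V'', h1]
  exact (((hf.hasDerivAt_Iic ξ).sub_const α).const_mul _).deriv

theorem gradV_eq_zero [IsProbabilityMeasure μ] [NullSingletonClass μ] (hα : α < 1) (hμ : Integrable id μ)
    {ξ : ℝ} (hξ : ξ ∈ argminV α μ) : gradV α μ ξ = 0 :=
  IsLocalMin.hasDerivAt_eq_zero (Eventually.of_forall fun ζ => hξ ζ) (hasDerivAt_V hα hμ ξ)

theorem measureReal_Iic_argmin [IsProbabilityMeasure μ] [NullSingletonClass μ] (hα : α < 1)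
    (hμ : Integrable id μ) {ξ : ℝ} (hξ : ξ ∈ argminV α μ) : μ.real (Set.Iic ξ) = α := by
  have h := gradV_eq_zero hα hμ hξ
  have : 0 < 1 / (1 - α) := by have : 0 < 1 - α := by linarith
                               positivity
  rcases mul_eq_zero.1 h with h | h <;> linarith

theorem gradV_mono [IsProbabilityMeasure μ] (hα : α < 1) : Monotone (gradV α μ) := by
  intro a b hab
  have : 0 < 1 - α := by linarith
  unfold gradV
  have h := measureReal_mono (μ := μ) (Set.Iic_subset_Iic.2 hab)
  gcongr

theorem gradV_le_one [IsProbabilityMeasure μ] (hα : α < 1) (ξ : ℝ) : gradV α μ ξ ≤ 1 := by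
  have h0 : 0 < 1 - α := by linarith
  have : μ.real (Set.Iic ξ) ≤ 1 := measureReal_le_one
  unfold gradV
  rw [one_div, inv_mul_le_iff₀ h0]; linarith

theorem one_le_kα (α : ℝ) : 1 ≤ kα α := le_max_left _ _

theorem abs_gradV_le [IsProbabilityMeasure μ] (hα : α < 1) (ξ : ℝ) :
    |gradV α μ ξ| ≤ kα α := by
  refine abs_le.2 ⟨?_, (gradV_le_one hα ξ).trans (one_le_kα α)⟩
  have h0 : 0 < 1 - α := by linarith
  have : 0 ≤ μ.real (Set.Iic ξ) := measureReal_nonneg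
  have h2 : α / (1 - α) ≤ kα α := le_max_right _ _
  have h3 : -(α / (1 - α)) ≤ gradV α μ ξ := by
    unfold gradV
    rw [div_eq_inv_mul, one_div, ← mul_neg]
    gcongr
    linarith
  linarith

theorem abs_V_sub_le [IsProbabilityMeasure μ] [NullSingletonClass μ] (hα : α < 1) (hμ : Integrable id μ)
    (ξ ζ : ℝ) : |V α μ ξ - V α μ ζ| ≤ kα α * |ξ - ζ| :=
  Convex.norm_image_sub_le_of_norm_hasDerivWithin_le (s := Set.univ)
    (fun x _ => (hasDerivAt_V hα hμ x).hasDerivWithinAt) (fun x _ => abs_gradV_le hα x)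
    convex_univ (Set.mem_univ ζ) (Set.mem_univ ξ)

theorem abs_H1_le (hα0 : 0 < α) (hα : α < 1) (ξ x : ℝ) : |H1 α ξ x| ≤ kα α := by
  have h0 : 0 < 1 - α := by linarith
  unfold H1 kα
  by_cases h : x ∈ Set.Ici ξ
  · rw [Set.indicator_of_mem h]
    refine le_max_of_le_right (le_of_eq ?_)
    rw [show 1 - 1 / (1 - α) * 1 = -(α / (1 - α)) by field_simp; ring, abs_neg,
      abs_of_nonneg (by positivity)]
  · rw [Set.indicator_of_notMem h]
    exact le_max_of_le_left (by simp)

theorem integral_H1 [IsProbabilityMeasure μ] [NullSingletonClass μ] (hα : α < 1) (ξ : ℝ) :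
    ∫ x, H1 α ξ x ∂μ = gradV α μ ξ := by
  have h0 : 1 - α ≠ 0 := by linarith
  have hi : Integrable ((Set.Ici ξ).indicator fun _ => (1 : ℝ)) μ :=
    (integrable_const 1).indicator measurableSet_Ici
  unfold H1 gradV
  rw [integral_sub (integrable_const _) (hi.const_mul _), integral_const_mul,
    integral_indicator measurableSet_Ici, setIntegral_const,
    measureReal_congr Ioi_ae_eq_Ici.symm, measureReal_Ioi]
  simp only [integral_const, probReal_univ, smul_eq_mul, mul_one]
  field_simp
  ring

theorem supNorm_nonneg (g : ℝ → ℝ) : 0 ≤ supNorm g := Real.iSup_nonneg fun _ => abs_nonneg _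

theorem le_supNorm {g : ℝ → ℝ} {M : ℝ} (h : ∀ x, |g x| ≤ M) (x : ℝ) : |g x| ≤ supNorm g :=
  le_ciSup (f := fun x => |g x|) ⟨M, by rintro _ ⟨x, rfl⟩; exact h x⟩ x

theorem supNorm_le {g : ℝ → ℝ} {M : ℝ} (h : ∀ x, |g x| ≤ M) : supNorm g ≤ M := ciSup_le h

theorem supNorm_const_mul {c : ℝ} (hc : 0 ≤ c) (g : ℝ → ℝ) :
    supNorm (fun x => c * g x) = c * supNorm g := by
  simp only [supNorm, abs_mul, abs_of_nonneg hc, Real.mul_iSup_of_nonneg hc]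

theorem lipSeminorm_nonneg (g : ℝ → ℝ) : 0 ≤ lipSeminorm g :=
  Real.iSup_nonneg fun _ => by positivity

theorem div_le_of_lipschitz {g : ℝ → ℝ} {L : NNReal} (h : LipschitzWith L g) (p : ℝ × ℝ) :
    |g p.1 - g p.2| / |p.1 - p.2| ≤ L := by
  rcases eq_or_ne p.1 p.2 with h' | h'
  · simp [h']
  · rw [div_le_iff₀ (abs_pos.2 (sub_ne_zero.2 h'))]
    exact h.dist_le_mul p.1 p.2

theorem lipSeminorm_le {g : ℝ → ℝ} {L : NNReal} (h : LipschitzWith L g) : lipSeminorm g ≤ L :=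
  ciSup_le (div_le_of_lipschitz h)

theorem abs_sub_le_lipSeminorm {g : ℝ → ℝ} {L : NNReal} (h : LipschitzWith L g) (x y : ℝ) :
    |g x - g y| ≤ lipSeminorm g * |x - y| := by
  rcases eq_or_ne x y with rfl | h'
  · simp
  · rw [← div_le_iff₀ (abs_pos.2 (sub_ne_zero.2 h'))]
    exact le_ciSup (f := fun p : ℝ × ℝ => |g p.1 - g p.2| / |p.1 - p.2|)
      ⟨L, by rintro _ ⟨p, rfl⟩; exact div_le_of_lipschitz h p⟩ (x, y)

/-- A vanishing seminorm makes `g` constant, and the only integrable constant on the line is 0. This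
keeps the quotient in `lambdaBarOf` from being a division by zero. -/
theorem lipSeminorm_pos {g : ℝ → ℝ} {L : NNReal} (h : LipschitzWith L g) (hg : Integrable g)
    {x : ℝ} (hx : g x ≠ 0) : 0 < lipSeminorm g := by
  refine (lipSeminorm_nonneg g).lt_of_ne fun h0 => ?_
  have hc : g = fun _ => g x := funext fun y => by
    have := abs_sub_le_lipSeminorm h y x
    rw [← h0, zero_mul] at this
    linarith [abs_nonpos_iff.1 this]
  rw [hc, integrable_const_iff] at hg
  rcases hg with hg | hg
  · exact hx hg
  · exact absurd hg.measure_univ_lt_top (by simp)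

theorem IsContinuousPdf.lipschitz_V'' [IsProbabilityMeasure μ] (hf : IsContinuousPdf μ f)
    (hα : α < 1) (hμ : Integrable id μ) {L : NNReal} (hL : LipschitzWith L f) :
    LipschitzWith (Real.toNNReal (1 / (1 - α)) * L) (V'' α μ) := by
  have h0 : 0 ≤ 1 / (1 - α) := by have : 0 < 1 - α := by linarith
                                  positivity
  rw [hf.V''_eq hα hμ]
  refine LipschitzWith.of_dist_le_mul fun x y => ?_
  rw [Real.dist_eq, ← mul_sub, abs_mul, abs_of_nonneg h0, NNReal.coe_mul,
    Real.coe_toNNReal _ h0, mul_assoc]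
  exact mul_le_mul_of_nonneg_left (hL.dist_le_mul x y) h0

theorem IsContinuousPdf.lipSeminorm_V''_pos [IsProbabilityMeasure μ] (hf : IsContinuousPdf μ f)
    (hα : α < 1) (hμ : Integrable id μ) {L : NNReal} (hL : LipschitzWith L f)
    {ξ : ℝ} (hξ : 0 < f ξ) : 0 < lipSeminorm (V'' α μ) := by
  have h0 : 0 < 1 / (1 - α) := by have : 0 < 1 - α := by linarith
                                  positivity
  refine lipSeminorm_pos (hf.lipschitz_V'' hα hμ hL) (x := ξ) ?_ ?_
  · rw [hf.V''_eq hα hμ]; exact hf.integrable.const_mul _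
  · rw [hf.V''_eq hα hμ]; positivity

theorem IsContinuousPdf.drift [IsProbabilityMeasure μ] (hf : IsContinuousPdf μ f) (hα : α < 1)
    (hμ : Integrable id μ) {L : NNReal} (hL : LipschitzWith L f) {ξ : ℝ} (hξ : ξ ∈ argminV α μ)
    (hfξ : 0 < f ξ) {θ lam : ℝ} (hθ : (1 / (1 - α)) * supNorm f ≤ θ)
    (hlam : lam ≤ lambdaBarOf 1 α μ ξ) (x : ℝ) :
    lam * (Real.cosh (θ * (x - ξ)) - 1) ≤ θ * gradV α μ x * Real.sinh (θ * (x - ξ)) := by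
  have := hf.nullSingletonClass
  have h0 : 0 < 1 / (1 - α) := by have : 0 < 1 - α := by linarith
                                  positivity
  have hV := hf.V''_eq hα hμ
  have hder : ∀ y, HasDerivAt (fun y => gradV α μ (ξ + y)) (V'' α μ (ξ + y)) y := fun y => by
    rw [hV]
    have h1 : HasDerivAt (gradV α μ) ((1 / (1 - α)) * f (ξ + y)) (ξ + y) :=
      ((hf.hasDerivAt_Iic _).sub_const α).const_mul _
    exact h1.comp_const_add ξ y
  have hm : 0 < V'' α μ ξ := by rw [hV]; positivity
  have hlam1 : lam ≤ 3 / 8 * V'' α μ ξ := by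
    refine hlam.trans ((min_le_left _ _).trans (le_of_eq ?_)); push_cast; ring
  have hlam2 : lam ≤ supNorm (V'' α μ) * (V'' α μ ξ ^ 4 / (4 * lipSeminorm (V'' α μ) ^ 2)) := by
    refine hlam.trans ((min_le_right _ _).trans (le_of_eq ?_)); push_cast; ring
  have := NestedSA.drift (θ := θ) hder (by simpa using gradV_eq_zero hα hμ hξ) hm
    (hf.lipSeminorm_V''_pos hα hμ hL hfξ)
    (fun y => by simpa using abs_sub_le_lipSeminorm (hf.lipschitz_V'' hα hμ hL) (ξ + y) ξ)
    (fun a b hab => gradV_mono hα (by linarith)) (fun y => gradV_le_one hα _)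
    (supNorm_nonneg _) (by rw [hV, supNorm_const_mul h0.le]; exact hθ) hlam1 hlam2 (x - ξ)
  simpa using this

end Loss

/-! ### Independence of an iterate and the next sample -/

section Independence

variable {Ω : Type*} [MeasurableSpace Ω] {P : Measure Ω}

/-- Both hypotheses factor the law of `(a, (b, c))` into a triple product, which is then
reassociated. -/
theorem indepFun_prodMk_of_indepFun {A B C : Type*} [MeasurableSpace A] [MeasurableSpace B]
    [MeasurableSpace C] [IsProbabilityMeasure P] {a : Ω → A} {b : Ω → B} {c : Ω → C}
    (ha : Measurable a) (hb : Measurable b) (hc : Measurable c)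
    (h : IndepFun a (fun ω => (b ω, c ω)) P) (hbc : IndepFun b c P) :
    IndepFun (fun ω => (a ω, b ω)) c P := by
  have := Measure.isProbabilityMeasure_map (μ := P) ha.aemeasurable
  have := Measure.isProbabilityMeasure_map (μ := P) hb.aemeasurable
  have := Measure.isProbabilityMeasure_map (μ := P) hc.aemeasurable
  have hab : IndepFun a b P := h.comp measurable_id measurable_fst
  rw [indepFun_iff_map_prod_eq_prod_map_map (ha.prodMk hb).aemeasurable hc.aemeasurable,
    (indepFun_iff_map_prod_eq_prod_map_map ha.aemeasurable hb.aemeasurable).1 hab]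
  have h1 := (indepFun_iff_map_prod_eq_prod_map_map ha.aemeasurable
    (hb.prodMk hc).aemeasurable).1 h
  rw [(indepFun_iff_map_prod_eq_prod_map_map hb.aemeasurable hc.aemeasurable).1 hbc,
    ← Measure.prodAssoc_prod] at h1
  apply MeasurableEquiv.prodAssoc.map_measurableEquiv_injective
  rw [← h1, Measure.map_map MeasurableEquiv.prodAssoc.measurable ((ha.prodMk hb).prodMk hc)]
  rfl

/-- This plays the role of conditioning on the past: Fubini on the product law freezes the current
iterate `T` while the fresh loss `X` is averaged. -/
theorem integral_le_of_indepFun {A B : Type*} [MeasurableSpace A] [MeasurableSpace B]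
    [IsProbabilityMeasure P] {T : Ω → A} {X : Ω → B} (hT : Measurable T) (hX : Measurable X)
    (hTX : IndepFun T X P) {Ψ : A × B → ℝ} {Φ : A → ℝ} (hΨ : Measurable Ψ) (hΦ : Measurable Φ)
    (hΨi : Integrable (fun ω => Ψ (T ω, X ω)) P) (hΦi : Integrable (fun ω => Φ (T ω)) P)
    (h : ∀ t, ∫ x, Ψ (t, x) ∂(P.map X) ≤ Φ t) :
    ∫ ω, Ψ (T ω, X ω) ∂P ≤ ∫ ω, Φ (T ω) ∂P := by
  have := Measure.isProbabilityMeasure_map (μ := P) hT.aemeasurable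
  have := Measure.isProbabilityMeasure_map (μ := P) hX.aemeasurable
  have hmap := (indepFun_iff_map_prod_eq_prod_map_map hT.aemeasurable hX.aemeasurable).1 hTX
  have hi : Integrable Ψ ((P.map T).prod (P.map X)) := by
    rw [← hmap]
    exact (integrable_map_measure hΨ.aestronglyMeasurable (hT.prodMk hX).aemeasurable).2 hΨi
  have hi2 : Integrable Φ (P.map T) :=
    (integrable_map_measure hΦ.aestronglyMeasurable hT.aemeasurable).2 hΦi
  calc ∫ ω, Ψ (T ω, X ω) ∂P = ∫ p, Ψ p ∂(P.map fun ω => (T ω, X ω)) :=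
        (integral_map (hT.prodMk hX).aemeasurable hΨ.aestronglyMeasurable).symm
    _ = ∫ t, ∫ x, Ψ (t, x) ∂(P.map X) ∂(P.map T) := by rw [hmap, integral_prod _ hi]
    _ ≤ ∫ t, Φ t ∂(P.map T) := integral_mono hi.integral_prod_left hi2 h
    _ = ∫ ω, Φ (T ω) ∂P := integral_map hT.aemeasurable hΦ.aestronglyMeasurable

/-- The random inputs of a stochastic approximation driven by independent losses of law `μ`. -/
structure IsDriven (P : Measure Ω) (p₀ : Ω → ℝ × ℝ) (X : ℕ → Ω → ℝ) (μ : Measure ℝ) : Prop where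
  measurable_init : Measurable p₀
  measurable_loss : ∀ n, Measurable (X n)
  map_loss : ∀ n, P.map (X n) = μ
  iIndepFun_loss : iIndepFun X P
  indepFun_init : IndepFun p₀ (fun ω n => X n ω) P

theorem measurable_H1 (α : ℝ) : Measurable fun p : ℝ × ℝ => H1 α p.1 p.2 := by
  have : (fun p : ℝ × ℝ => H1 α p.1 p.2)
      = fun p => 1 - (1 / (1 - α)) * {p : ℝ × ℝ | p.1 ≤ p.2}.indicator (fun _ => (1 : ℝ)) p := by
    funext p
    simp only [H1, Set.indicator, Set.mem_Ici, Set.mem_ofPred_eq]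
  rw [this]
  exact measurable_const.sub
    ((measurable_const.indicator (measurableSet_le measurable_fst measurable_snd)).const_mul _)

theorem measurable_H2 (α : ℝ) :
    Measurable fun p : (ℝ × ℝ) × ℝ => H2 α p.1.1 p.1.2 p.2 := by
  unfold H2; fun_prop

theorem saIter_congr (α : ℝ) (γ : ℕ → ℝ) (p : ℝ × ℝ) {x y : ℕ → ℝ} {n : ℕ}
    (h : ∀ i < n, x i = y i) : saIter α γ p x n = saIter α γ p y n := by
  induction n with
  | zero => rfl
  | succ n ih => simp only [saIter, ih fun i hi => h i (by omega), h n (by omega)]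

theorem measurable_saIter (α : ℝ) (γ : ℕ → ℝ) (n : ℕ) :
    Measurable fun q : (ℝ × ℝ) × (ℕ → ℝ) => saIter α γ q.1 q.2 n := by
  induction n with
  | zero => exact measurable_fst
  | succ n ih =>
    have hx : Measurable fun q : (ℝ × ℝ) × (ℕ → ℝ) => q.2 n :=
      (measurable_pi_apply n).comp measurable_snd
    exact (ih.fst.sub (((measurable_H1 α).comp (ih.fst.prodMk hx)).const_mul _)).prodMk
      (ih.snd.sub (((measurable_H2 α).comp (ih.prodMk hx)).const_mul _))

variable {p₀ : Ω → ℝ × ℝ} {X : ℕ → Ω → ℝ} {μ : Measure ℝ}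

theorem IsDriven.measurable_saIter (h : IsDriven P p₀ X μ) (α : ℝ) (γ : ℕ → ℝ) (n : ℕ) :
    Measurable fun ω => saIter α γ (p₀ ω) (fun n => X n ω) n :=
  (NestedSA.measurable_saIter α γ n).comp
    (h.measurable_init.prodMk (measurable_pi_lambda _ h.measurable_loss))

theorem IsDriven.indepFun [IsProbabilityMeasure P] (h : IsDriven P p₀ X μ) (α : ℝ) (γ : ℕ → ℝ)
    (n : ℕ) : IndepFun (fun ω => saIter α γ (p₀ ω) (fun n => X n ω) n) (X n) P := by
  let b : Ω → (Finset.range n → ℝ) := fun ω i => X i ω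
  have hb : Measurable b := measurable_pi_lambda _ fun i => h.measurable_loss i
  have hbc : IndepFun b (X n) P := by
    have := h.iIndepFun_loss.indepFun_finset (Finset.range n) {n} (by simp) h.measurable_loss
    exact this.comp measurable_id
      (measurable_pi_apply (⟨n, by simp⟩ : ({n} : Finset ℕ)))
  have habc : IndepFun p₀ (fun ω => (b ω, X n ω)) P := by
    have hm : Measurable fun x : ℕ → ℝ => ((fun i : Finset.range n => x i), x n) :=
      (measurable_pi_lambda _ fun i => measurable_pi_apply _).prodMk (measurable_pi_apply _)
    exact h.indepFun_init.comp measurable_id hm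
  have hmain := indepFun_prodMk_of_indepFun h.measurable_init hb (h.measurable_loss n) habc hbc
  -- The iterate `n` depends on the losses with index below `n` only, so padding them by 0 does not
  -- change it and exhibits it as a function of `(p₀, b)`.
  let ext : (Finset.range n → ℝ) → ℕ → ℝ := fun y i =>
    if hi : i ∈ Finset.range n then y ⟨i, hi⟩ else 0
  have hext : Measurable ext := by
    refine measurable_pi_lambda _ fun i => ?_
    by_cases hi : i ∈ Finset.range n
    · simp only [ext, hi, dite_true]
      exact measurable_pi_apply _
    · simp only [ext, hi, dite_false]
      exact measurable_const
  have hcomp := hmain.comp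
    ((NestedSA.measurable_saIter α γ n).comp (measurable_fst.prodMk (hext.comp measurable_snd)))
    measurable_id
  refine hcomp.congr (Eventually.of_forall fun ω => Eq.symm ?_) (Eventually.of_forall fun _ => rfl)
  refine saIter_congr _ _ _ fun i hi => ?_
  simp [ext, b, hi]

end Independence

/-! ### Convergence rates uniform in the law of the losses -/

section Rates

theorem exp_sub_one_sub_le {u : ℝ} (hu : 0 ≤ u) : Real.exp u - 1 - u ≤ u ^ 2 * Real.exp u := by
  have h1 : 1 - u ≤ Real.exp (-u) := by have := Real.add_one_le_exp (-u); linarith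
  have h3 : Real.exp u * Real.exp (-u) = 1 := by rw [← Real.exp_add]; simp
  have h4 := mul_le_mul_of_nonneg_left h1 (Real.exp_pos u).le
  have h5 : Real.exp u - 1 ≤ u * Real.exp u := by linarith
  have h6 := mul_le_mul_of_nonneg_left h5 hu
  linarith

theorem cosh_add_le_of_nonneg (a : ℝ) {u : ℝ} (hu : 0 ≤ u) :
    Real.cosh (a + u) ≤ Real.cosh a + u * Real.sinh a + u ^ 2 * Real.exp u * Real.cosh a := by
  have h1 : u ≤ Real.sinh u := Real.self_le_sinh_iff.2 hu
  have h2 : Real.sinh a ≤ Real.cosh a := (Real.sinh_lt_cosh a).le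
  have h3 : Real.cosh u + Real.sinh u = Real.exp u := Real.cosh_add_sinh u
  have h4 := mul_le_mul_of_nonneg_right h2 (sub_nonneg.2 h1)
  have h5 := mul_le_mul_of_nonneg_right (exp_sub_one_sub_le hu) (Real.cosh_pos a).le
  rw [← h3] at h5
  rw [Real.cosh_add, ← h3]
  linarith

/-- The remainder is proportional to `cosh a`; this lets the recursion for the mean of `cosh` close
on itself. -/
theorem cosh_add_le (a u : ℝ) :
    Real.cosh (a + u) ≤ Real.cosh a + u * Real.sinh a + u ^ 2 * Real.exp |u| * Real.cosh a := by
  rcases le_total 0 u with hu | hu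
  · rw [abs_of_nonneg hu]; exact cosh_add_le_of_nonneg a hu
  · have := cosh_add_le_of_nonneg (-a) (neg_nonneg.2 hu)
    rw [← neg_add, Real.cosh_neg, Real.cosh_neg, Real.sinh_neg] at this
    rw [abs_of_nonpos hu]
    simpa using this

/-- Since the increments of `ξ` are bounded, this propagates the integrability of `cosh` from one
iterate to the next. -/
theorem cosh_add_le_exp_mul (a u : ℝ) : Real.cosh (a + u) ≤ Real.exp |u| * Real.cosh a := by
  have h1 : |Real.sinh a| ≤ Real.cosh a := by
    rw [Real.abs_sinh, ← Real.cosh_abs a]; exact (Real.sinh_lt_cosh _).le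
  have h2 : Real.sinh a * Real.sinh u ≤ Real.cosh a * |Real.sinh u| := by
    refine (le_abs_self _).trans ?_
    rw [abs_mul]; gcongr
  have h3 : Real.cosh u + |Real.sinh u| = Real.exp |u| := by
    rw [← Real.cosh_abs u, Real.abs_sinh]; exact Real.cosh_add_sinh _
  rw [Real.cosh_add, ← h3]
  linarith

theorem sq_le_cosh (x : ℝ) : x ^ 2 / 2 ≤ Real.cosh x - 1 := by
  have h1 : Real.cosh x = 1 + 2 * Real.sinh (x / 2) ^ 2 := by
    rw [show x = 2 * (x / 2) by ring, Real.cosh_two_mul, Real.cosh_sq, ← show x = 2 * (x / 2) by ring]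
    ring
  have h2 : |x / 2| ≤ |Real.sinh (x / 2)| := by
    rw [Real.abs_sinh]; exact Real.self_le_sinh_iff.2 (abs_nonneg _)
  have h3 := sq_le_sq.2 h2
  rw [h1]
  linarith

/-- The function `ξ + (x - ξ)⁺ / (1 - α)`, whose mean is `V(ξ)`. -/
noncomputable def psi (α ξ x : ℝ) : ℝ := ξ + (1 / (1 - α)) * max (x - ξ) 0

variable {Ω : Type*} {α : ℝ} {p₀ : Ω → ℝ × ℝ} {X : ℕ → Ω → ℝ}

/-- The `n`-th iterate on the random inputs at `ω`. -/
noncomputable def iterate (α : ℝ) (γ : ℕ → ℝ) (p₀ : Ω → ℝ × ℝ) (X : ℕ → Ω → ℝ) (n : ℕ) (ω : Ω) :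
    ℝ × ℝ :=
  saIter α γ (p₀ ω) (fun n => X n ω) n

theorem iterate_succ_fst (γ : ℕ → ℝ) (n : ℕ) (ω : Ω) :
    (iterate α γ p₀ X (n + 1) ω).1
      = (iterate α γ p₀ X n ω).1 - γ (n + 1) * H1 α (iterate α γ p₀ X n ω).1 (X n ω) := rfl

theorem iterate_succ_snd (γ : ℕ → ℝ) (n : ℕ) (ω : Ω) :
    (iterate α γ p₀ X (n + 1) ω).2
      = (1 - 1 / ((n : ℝ) + 1)) * (iterate α γ p₀ X n ω).2
        + 1 / ((n : ℝ) + 1) * psi α (iterate α γ p₀ X n ω).1 (X n ω) := by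
  change (iterate α γ p₀ X n ω).2 - _ * H2 α _ _ _ = _
  unfold H2 psi
  ring!

variable [MeasurableSpace Ω] {P : Measure Ω}

/-- A stochastic approximation whose losses have the law `μ` with density `f`, together with the
bounds that the rates of convergence depend on. -/
structure IsModel (P : Measure Ω) (α θ lam B : ℝ) (p₀ : Ω → ℝ × ℝ) (X : ℕ → Ω → ℝ)
    (μ : Measure ℝ) (f : ℝ → ℝ) (ξ : ℝ) : Prop where
  driven : IsDriven P p₀ X μ
  prob : IsProbabilityMeasure μ
  pdf : IsContinuousPdf μ f
  memLp : MemLp id 2 μ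
  lipschitz : ∃ L : NNReal, LipschitzWith L f
  argmin : ξ ∈ argminV α μ
  density_pos : 0 < f ξ
  supNorm_le : (1 / (1 - α)) * supNorm f ≤ θ
  lam_le : lam ≤ lambdaBarOf 1 α μ ξ
  memLp_fst : MemLp (fun ω => (p₀ ω).1) 2 P
  memLp_snd : MemLp (fun ω => (p₀ ω).2) 2 P
  integrable_cosh : Integrable (fun ω => Real.cosh (θ * ((p₀ ω).1 - ξ))) P
  integral_cosh_le : ∫ ω, (Real.cosh (θ * ((p₀ ω).1 - ξ)) - 1) ∂P ≤ B
  variance_le : ∫ x, (psi α ξ x - V α μ ξ) ^ 2 ∂μ ≤ B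

variable {θ lam B : ℝ} {μ : Measure ℝ} {f : ℝ → ℝ} {ξ : ℝ}

theorem IsModel.measurable (h : IsModel P α θ lam B p₀ X μ f ξ) (γ : ℕ → ℝ) (n : ℕ) :
    Measurable (iterate α γ p₀ X n) :=
  h.driven.measurable_saIter α γ n

theorem integral_psi (hμ : Integrable id μ) [IsProbabilityMeasure μ] (ζ : ℝ) :
    ∫ x, psi α ζ x ∂μ = V α μ ζ := by
  unfold psi V
  rw [integral_add (integrable_const _) ((integrable_max_sub hμ ζ).const_mul _),
    integral_const_mul]
  simp

theorem abs_psi_sub_le (hα : α < 1) (ζ η x : ℝ) :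
    |psi α ζ x - psi α η x| ≤ (1 + 1 / (1 - α)) * |ζ - η| := by
  have h0 : 0 ≤ 1 / (1 - α) := by have : 0 < 1 - α := by linarith
                                  positivity
  have h1 : |max (x - ζ) 0 - max (x - η) 0| ≤ |ζ - η| := by
    refine (abs_max_sub_max_le_abs _ _ _).trans (le_of_eq ?_)
    rw [abs_sub_comm]; congr 1; ring
  calc _ = |(ζ - η) + (1 / (1 - α)) * (max (x - ζ) 0 - max (x - η) 0)| := by
        unfold psi; congr 1; ring
    _ ≤ |ζ - η| + (1 / (1 - α)) * |max (x - ζ) 0 - max (x - η) 0| := by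
        refine (abs_add_le _ _).trans ?_
        rw [abs_mul, abs_of_nonneg h0]
    _ ≤ |ζ - η| + (1 / (1 - α)) * |ζ - η| := by gcongr
    _ = _ := by ring

theorem measurable_psi (α : ℝ) : Measurable fun p : ℝ × ℝ => psi α p.1 p.2 := by
  unfold psi; fun_prop

theorem memLp_psi_comp {Ω' : Type*} [MeasurableSpace Ω'] {Q : Measure Ω'} [IsFiniteMeasure Q]
    {a b : Ω' → ℝ} (ha : MemLp a 2 Q) (hb : MemLp b 2 Q) (α : ℝ) :
    MemLp (fun ω => psi α (a ω) (b ω)) 2 Q := by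
  refine ha.add (MemLp.const_mul (?_ : MemLp (fun ω => max (b ω - a ω) 0) 2 Q) _)
  exact (hb.sub ha).pos_part

theorem IsModel.memLp_iterate [IsProbabilityMeasure P] (h : IsModel P α θ lam B p₀ X μ f ξ)
    (hα0 : 0 < α) (hα : α < 1) (γ : ℕ → ℝ) (n : ℕ) :
    MemLp (fun ω => (iterate α γ p₀ X n ω).1) 2 P ∧
      MemLp (fun ω => (iterate α γ p₀ X n ω).2) 2 P := by
  have hX : ∀ n, MemLp (X n) 2 P := fun n => by
    have := h.memLp
    rw [← h.driven.map_loss n, memLp_map_measure_iff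
      aestronglyMeasurable_id (h.driven.measurable_loss n).aemeasurable] at this
    exact this
  induction n with
  | zero => exact ⟨h.memLp_fst, h.memLp_snd⟩
  | succ n ih =>
    simp only [iterate_succ_fst, iterate_succ_snd]
    refine ⟨ih.1.sub (MemLp.const_mul (MemLp.of_bound ?_ (kα α)
      (Eventually.of_forall fun ω => abs_H1_le hα0 hα _ _)) _), ?_⟩
    · exact ((measurable_H1 α).comp
        ((h.measurable γ n).fst.prodMk (h.driven.measurable_loss n))).aestronglyMeasurable
    · exact (ih.2.const_mul _).add ((memLp_psi_comp ih.1 (hX n) α).const_mul _)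

theorem IsModel.integrable_cosh_iterate [IsProbabilityMeasure P]
    (h : IsModel P α θ lam B p₀ X μ f ξ) (hα0 : 0 < α) (hα : α < 1) (γ : ℕ → ℝ) (n : ℕ) :
    Integrable (fun ω => Real.cosh (θ * ((iterate α γ p₀ X n ω).1 - ξ))) P := by
  induction n with
  | zero => exact h.integrable_cosh
  | succ n ih =>
    refine (ih.const_mul (Real.exp (|θ * γ (n + 1)| * kα α))).mono' ?_
      (Eventually.of_forall fun ω => ?_)
    · exact (Real.measurable_cosh.comp
        (((h.measurable γ (n + 1)).fst.sub_const ξ).const_mul θ)).aestronglyMeasurable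
    · rw [Real.norm_eq_abs, abs_of_pos (Real.cosh_pos _), iterate_succ_fst]
      set t := (iterate α γ p₀ X n ω).1
      have h1 := cosh_add_le_exp_mul (θ * (t - ξ)) (-(θ * γ (n + 1) * H1 α t (X n ω)))
      have h2 : |-(θ * γ (n + 1) * H1 α t (X n ω))| ≤ |θ * γ (n + 1)| * kα α := by
        rw [abs_neg, abs_mul]
        gcongr
        exact abs_H1_le hα0 hα _ _
      calc _ = Real.cosh (θ * (t - ξ) + -(θ * γ (n + 1) * H1 α t (X n ω))) := by
            congr 1; ring
        _ ≤ _ := h1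
        _ ≤ _ := by gcongr

/-- In the expansion of `cosh`, the first order term averages to `-a θ V'(t) sinh`, controlled by
the drift inequality. The remainder `D a² cosh` is split as `D a² (cosh - 1) + D a²`. -/
theorem integral_cosh_step_le [IsProbabilityMeasure μ] (hα0 : 0 < α) (hα : α < 1)
    (hf : IsContinuousPdf μ f) (hμ : Integrable id μ) {L : NNReal} (hL : LipschitzWith L f)
    (hξ : ξ ∈ argminV α μ) (hfξ : 0 < f ξ) (hθ : (1 / (1 - α)) * supNorm f ≤ θ) (hθ0 : 0 ≤ θ)
    (hlam : lam ≤ lambdaBarOf 1 α μ ξ) {a c : ℝ} (ha : 0 ≤ a) (hac : a ≤ c) (t : ℝ) :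
    ∫ x, (Real.cosh (θ * (t - a * H1 α t x - ξ)) - 1) ∂μ
      ≤ (1 - lam * a + (θ * kα α) ^ 2 * Real.exp (θ * c * kα α) * a ^ 2)
          * (Real.cosh (θ * (t - ξ)) - 1)
        + (θ * kα α) ^ 2 * Real.exp (θ * c * kα α) * a ^ 2 := by
  have := hf.nullSingletonClass
  set D := (θ * kα α) ^ 2 * Real.exp (θ * c * kα α) with hD
  have hk : 0 ≤ kα α := zero_le_one.trans (one_le_kα α)
  have hH1m : Measurable fun x => H1 α t x := (measurable_H1 α).comp measurable_prodMk_left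
  have hHi : Integrable (fun x => H1 α t x) μ :=
    Integrable.of_bound hH1m.aestronglyMeasurable (kα α)
      (Eventually.of_forall fun x => abs_H1_le hα0 hα _ _)
  have hpt : ∀ x, Real.cosh (θ * (t - a * H1 α t x - ξ)) - 1
      ≤ (Real.cosh (θ * (t - ξ)) - 1 + D * a ^ 2 * Real.cosh (θ * (t - ξ)))
        + (-(θ * a) * Real.sinh (θ * (t - ξ))) * H1 α t x := by
    intro x
    have h1 := cosh_add_le (θ * (t - ξ)) (-(θ * a * H1 α t x))
    have h2 : |-(θ * a * H1 α t x)| ≤ θ * a * kα α := by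
      rw [abs_neg, abs_mul, abs_of_nonneg (mul_nonneg hθ0 ha)]
      gcongr
      exact abs_H1_le hα0 hα _ _
    have h3 : (-(θ * a * H1 α t x)) ^ 2 * Real.exp |-(θ * a * H1 α t x)| ≤ D * a ^ 2 := by
      rw [← sq_abs (-(θ * a * H1 α t x))]
      calc _ ≤ (θ * a * kα α) ^ 2 * Real.exp (θ * c * kα α) := by
            gcongr
            exact h2.trans (by gcongr)
        _ = _ := by rw [hD]; ring
    have h4 := mul_le_mul_of_nonneg_right h3 (Real.cosh_pos (θ * (t - ξ))).le
    rw [show θ * (t - a * H1 α t x - ξ) = θ * (t - ξ) + -(θ * a * H1 α t x) by ring]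
    linarith
  have hdrift := hf.drift hα hμ hL hξ hfξ hθ hlam t
  have hle := mul_le_mul_of_nonneg_left hdrift ha
  have hc := Real.cosh_pos (θ * (t - ξ))
  calc _ ≤ ∫ x, ((Real.cosh (θ * (t - ξ)) - 1 + D * a ^ 2 * Real.cosh (θ * (t - ξ)))
        + (-(θ * a) * Real.sinh (θ * (t - ξ))) * H1 α t x) ∂μ := by
        refine integral_mono_of_nonneg (Eventually.of_forall fun x => ?_)
          ((integrable_const _).add (hHi.const_mul _)) (Eventually.of_forall hpt)
        have := Real.one_le_cosh (θ * (t - a * H1 α t x - ξ))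
        exact sub_nonneg.2 this
    _ = (Real.cosh (θ * (t - ξ)) - 1 + D * a ^ 2 * Real.cosh (θ * (t - ξ)))
        + (-(θ * a) * Real.sinh (θ * (t - ξ))) * gradV α μ t := by
        rw [integral_add (integrable_const _) (hHi.const_mul _), integral_const_mul,
          integral_H1 hα]
        simp
    _ ≤ _ := by linarith

theorem IsModel.integral_cosh_succ_le [IsProbabilityMeasure P]
    (h : IsModel P α θ lam B p₀ X μ f ξ) (hα0 : 0 < α) (hα : α < 1) (hθ0 : 0 ≤ θ)
    {γ : ℕ → ℝ} {c : ℝ} {n : ℕ} (hγ0 : 0 ≤ γ (n + 1)) (hγ : γ (n + 1) ≤ c) :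
    ∫ ω, (Real.cosh (θ * ((iterate α γ p₀ X (n + 1) ω).1 - ξ)) - 1) ∂P
      ≤ (1 - lam * γ (n + 1) + (θ * kα α) ^ 2 * Real.exp (θ * c * kα α) * γ (n + 1) ^ 2)
          * ∫ ω, (Real.cosh (θ * ((iterate α γ p₀ X n ω).1 - ξ)) - 1) ∂P
        + (θ * kα α) ^ 2 * Real.exp (θ * c * kα α) * γ (n + 1) ^ 2 := by
  have := h.prob
  obtain ⟨L, hL⟩ := h.lipschitz
  have hi := h.integrable_cosh_iterate hα0 hα γ
  have hin : Integrable (fun ω => Real.cosh (θ * ((iterate α γ p₀ X n ω).1 - ξ)) - 1) P :=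
    (hi n).sub (integrable_const 1)
  have key := integral_le_of_indepFun (h.measurable γ n).fst (h.driven.measurable_loss n)
    ((h.driven.indepFun α γ n).comp measurable_fst measurable_id)
    (Ψ := fun p => Real.cosh (θ * (p.1 - γ (n + 1) * H1 α p.1 p.2 - ξ)) - 1)
    (Φ := fun t => (1 - lam * γ (n + 1)
      + (θ * kα α) ^ 2 * Real.exp (θ * c * kα α) * γ (n + 1) ^ 2)
          * (Real.cosh (θ * (t - ξ)) - 1)
        + (θ * kα α) ^ 2 * Real.exp (θ * c * kα α) * γ (n + 1) ^ 2)
    ((Real.measurable_cosh.comp (((measurable_fst.sub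
      ((measurable_H1 α).const_mul _)).sub_const ξ).const_mul θ)).sub_const 1)
    (by fun_prop) ((hi (n + 1)).sub (integrable_const 1))
    ((hin.const_mul _).add (integrable_const _))
    (by
      rw [h.driven.map_loss]
      exact integral_cosh_step_le hα0 hα h.pdf (h.memLp.integrable one_le_two) hL h.argmin
        h.density_pos h.supNorm_le hθ0 h.lam_le hγ0 hγ)
  refine key.trans (le_of_eq ?_)
  rw [integral_add (hin.const_mul _) (integrable_const _), integral_const_mul]
  simp

/-- The square is expanded around the deterministic part `a`. The mean of `psi` deviates from the
minimum by at most `kα |t - ξ|`, and its second moment is compared with the one at `ξ`, bounded by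
`B`. -/
theorem integral_sq_step_le [IsProbabilityMeasure μ] (hα : α < 1) (hμ : MemLp id 2 μ)
    [NullSingletonClass μ]
    (hvar : ∫ x, (psi α ξ x - V α μ ξ) ^ 2 ∂μ ≤ B) {s : ℝ} (hs0 : 0 < s)
    (t d : ℝ) :
    ∫ x, ((1 - s) * (d - V α μ ξ) + s * (psi α t x - V α μ ξ)) ^ 2 ∂μ
      ≤ (1 - s) ^ 2 * (1 + s / 2) * (d - V α μ ξ) ^ 2
        + (3 * s * kα α ^ 2 + 2 * s ^ 2 * (1 + 1 / (1 - α)) ^ 2) * (t - ξ) ^ 2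
        + 2 * s ^ 2 * B := by
  have hμ1 : Integrable id μ := hμ.integrable one_le_two
  set A := V α μ ξ
  set a := (1 - s) * (d - A) with ha
  set k := 1 + 1 / (1 - α)
  have hψ : ∀ t, MemLp (fun x => psi α t x - A) 2 μ := fun t =>
    (memLp_psi_comp (memLp_const t) hμ α).sub (memLp_const A)
  have hψi : ∀ t, Integrable (fun x => psi α t x - A) μ := fun t =>
    (hψ t).integrable one_le_two
  have hψm : ∫ x, (psi α t x - A) ∂μ = V α μ t - A := by
    have hi : Integrable (fun x => psi α t x) μ :=
      (memLp_psi_comp (memLp_const t) hμ α).integrable one_le_two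
    rw [integral_sub hi (integrable_const _), integral_psi hμ1]
    simp
  have h2 : ∫ x, (psi α t x - A) ^ 2 ∂μ ≤ 2 * k ^ 2 * (t - ξ) ^ 2 + 2 * B := by
    have hpt : ∀ x, (psi α t x - A) ^ 2
        ≤ 2 * k ^ 2 * (t - ξ) ^ 2 + 2 * (psi α ξ x - A) ^ 2 := fun x => by
      have h3 : (psi α t x - psi α ξ x) ^ 2 ≤ k ^ 2 * (t - ξ) ^ 2 := by
        rw [← mul_pow, ← sq_abs, ← sq_abs (k * (t - ξ)), abs_mul]
        gcongr
        exact (abs_psi_sub_le hα t ξ x).trans (by gcongr; exact le_abs_self _)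
      nlinarith [sq_nonneg ((psi α t x - psi α ξ x) - (psi α ξ x - A))]
    have hi : Integrable (fun x => 2 * (psi α ξ x - A) ^ 2) μ := (hψ ξ).integrable_sq.const_mul 2
    refine (integral_mono (g := fun x => 2 * k ^ 2 * (t - ξ) ^ 2 + 2 * (psi α ξ x - A) ^ 2)
      (hψ t).integrable_sq ((integrable_const _).add hi) hpt).trans ?_
    rw [integral_add (integrable_const _) hi, integral_const_mul 2]
    simp only [integral_const, probReal_univ, smul_eq_mul, one_mul]
    linarith
  have h1 : ∫ x, (a + s * (psi α t x - A)) ^ 2 ∂μ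
      = a ^ 2 + 2 * a * s * (V α μ t - A) + s ^ 2 * ∫ x, (psi α t x - A) ^ 2 ∂μ := by
    have : ∀ x, (a + s * (psi α t x - A)) ^ 2
        = (a ^ 2 + 2 * a * s * (psi α t x - A)) + s ^ 2 * (psi α t x - A) ^ 2 := fun x => by ring
    simp only [this]
    have hi1 : Integrable (fun x => 2 * a * s * (psi α t x - A)) μ := (hψi t).const_mul _
    have hi2 : Integrable (fun x => a ^ 2 + 2 * a * s * (psi α t x - A)) μ :=
      (integrable_const _).add hi1
    rw [integral_add hi2 ((hψ t).integrable_sq.const_mul _), integral_add (integrable_const _) hi1,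
      integral_const_mul, integral_const_mul, hψm]
    simp
  have hV : (V α μ t - A) ^ 2 ≤ kα α ^ 2 * (t - ξ) ^ 2 := by
    rw [← mul_pow, ← sq_abs, ← sq_abs (kα α * (t - ξ)), abs_mul]
    gcongr
    exact (abs_V_sub_le hα hμ1 t ξ).trans (by gcongr; exact le_abs_self _)
  set v := V α μ t - A
  -- Young's inequality with weight `s / 2`: it costs a quarter of the contraction `2s` of `(1 -
  -- s)²`, leaving the rate `3/2`.
  have h5 : a ^ 2 + 2 * a * s * v ≤ (1 + s / 2) * a ^ 2 + 2 * s * v ^ 2 := by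
    have : 0 ≤ s / 2 * (a - 2 * v) ^ 2 := by positivity
    nlinarith
  have h6 : (1 + s / 2) * a ^ 2 = (1 - s) ^ 2 * (1 + s / 2) * (d - A) ^ 2 := by
    rw [ha]; ring
  have h7 : 2 * s * v ^ 2 ≤ 3 * s * (kα α ^ 2 * (t - ξ) ^ 2) := by
    have : 0 ≤ s * v ^ 2 := by positivity
    have := mul_le_mul_of_nonneg_left hV hs0.le
    linarith
  have h8 := mul_le_mul_of_nonneg_left h2 (sq_nonneg s)
  rw [h1]
  linarith

theorem IsModel.integral_sq_succ_le [IsProbabilityMeasure P]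
    (h : IsModel P α θ lam B p₀ X μ f ξ) (hα0 : 0 < α) (hα : α < 1) (γ : ℕ → ℝ) (n : ℕ) {s : ℝ}
    (hs : s = 1 / ((n : ℝ) + 1)) :
    ∫ ω, ((iterate α γ p₀ X (n + 1) ω).2 - V α μ ξ) ^ 2 ∂P
      ≤ (1 - s) ^ 2 * (1 + s / 2) * ∫ ω, ((iterate α γ p₀ X n ω).2 - V α μ ξ) ^ 2 ∂P
        + (3 * s * kα α ^ 2 + 2 * s ^ 2 * (1 + 1 / (1 - α)) ^ 2)
          * ∫ ω, ((iterate α γ p₀ X n ω).1 - ξ) ^ 2 ∂P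
        + 2 * s ^ 2 * B := by
  have := h.prob
  have := h.pdf.nullSingletonClass
  have hs0 : 0 < s := by rw [hs]; positivity
  have hs1 : s ≤ 1 := by
    rw [hs, div_le_one (by positivity)]; linarith [Nat.cast_nonneg (α := ℝ) n]
  have hLp := h.memLp_iterate hα0 hα γ
  have hi1 : Integrable (fun ω => ((iterate α γ p₀ X n ω).1 - ξ) ^ 2) P :=
    ((hLp n).1.sub (memLp_const ξ)).integrable_sq
  have hi2 : ∀ n, Integrable (fun ω => ((iterate α γ p₀ X n ω).2 - V α μ ξ) ^ 2) P := fun n =>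
    ((hLp n).2.sub (memLp_const (V α μ ξ))).integrable_sq
  have hstep : ∀ ω, (iterate α γ p₀ X (n + 1) ω).2 - V α μ ξ
      = (1 - s) * ((iterate α γ p₀ X n ω).2 - V α μ ξ)
        + s * (psi α (iterate α γ p₀ X n ω).1 (X n ω) - V α μ ξ) := fun ω => by
    rw [iterate_succ_snd, hs]; ring
  have hi3 := hi2 (n + 1)
  simp only [hstep] at hi3 ⊢
  have hi4 := (hi2 n).const_mul ((1 - s) ^ 2 * (1 + s / 2))
  have hi5 := hi1.const_mul (3 * s * kα α ^ 2 + 2 * s ^ 2 * (1 + 1 / (1 - α)) ^ 2)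
  have hi6 : Integrable (fun ω => (1 - s) ^ 2 * (1 + s / 2)
        * ((iterate α γ p₀ X n ω).2 - V α μ ξ) ^ 2
      + (3 * s * kα α ^ 2 + 2 * s ^ 2 * (1 + 1 / (1 - α)) ^ 2)
        * ((iterate α γ p₀ X n ω).1 - ξ) ^ 2) P := hi4.add hi5
  have key := integral_le_of_indepFun (h.measurable γ n) (h.driven.measurable_loss n)
    (h.driven.indepFun α γ n)
    (Ψ := fun p => ((1 - s) * (p.1.2 - V α μ ξ) + s * (psi α p.1.1 p.2 - V α μ ξ)) ^ 2)
    (Φ := fun t => (1 - s) ^ 2 * (1 + s / 2) * (t.2 - V α μ ξ) ^ 2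
      + (3 * s * kα α ^ 2 + 2 * s ^ 2 * (1 + 1 / (1 - α)) ^ 2) * (t.1 - ξ) ^ 2 + 2 * s ^ 2 * B)
    (((measurable_fst.snd.sub_const _).const_mul _).add
      ((((measurable_psi α).comp (measurable_fst.fst.prodMk measurable_snd)).sub_const
        _).const_mul _) |>.pow_const 2)
    (by fun_prop) hi3 (hi6.add (integrable_const _))
    (fun t => by
      rw [h.driven.map_loss]
      exact integral_sq_step_le hα h.memLp h.variance_le hs0 t.1 t.2)
  refine key.trans (le_of_eq ?_)
  rw [integral_add hi6 (integrable_const _), integral_add hi4 hi5, integral_const_mul,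
    integral_const_mul]
  simp

theorem learningRate_succ (γ₁ β : ℝ) (n : ℕ) :
    learningRate γ₁ β (n + 1) = γ₁ * ((n : ℝ) + 1) ^ (-β) := by
  unfold learningRate; push_cast; rfl

theorem exists_rate_fst [IsProbabilityMeasure P] (hα0 : 0 < α) (hα : α < 1) (hθ : 0 < θ)
    (hlam : 0 < lam) (B : ℝ) {β γ₁ : ℝ} (hadm : Admissible lam β γ₁) :
    ∃ C, 0 ≤ C ∧ ∀ (p₀ : Ω → ℝ × ℝ) (X : ℕ → Ω → ℝ) (μ : Measure ℝ) (f : ℝ → ℝ) (ξ : ℝ),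
      IsModel P α θ lam B p₀ X μ f ξ → ∀ n : ℕ,
        ∫ ω, ((iterate α (learningRate γ₁ β) p₀ X n ω).1 - ξ) ^ 2 ∂P
          ≤ C * ((n : ℝ) + 1) ^ (-β) := by
  have hβ := hadm.β_pos
  have hγ₁ := hadm.γ₁_pos
  set D := (θ * kα α) ^ 2 * Real.exp (θ * γ₁ * kα α) with hD
  have hD0 : 0 ≤ D := by positivity
  obtain ⟨C, hC0, hC⟩ := exists_bound_of_recursion (b := β) hγ₁ hβ hlam hβ hadm.β_le_one
    (hadm.β_le_one.lt_or_eq.imp id fun h => ⟨h, by rw [h]; exact hadm.restriction h⟩)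
    (D * (1 + γ₁)) (max B 0) (by positivity) (le_max_right _ _)
  refine ⟨2 / θ ^ 2 * C, by positivity, fun p₀ X μ f ξ h n => ?_⟩
  set γ := learningRate γ₁ β
  have hi := h.integrable_cosh_iterate hα0 hα γ
  have hrate := hC (fun n => ∫ ω, (Real.cosh (θ * ((iterate α γ p₀ X n ω).1 - ξ)) - 1) ∂P)
    (fun n => integral_nonneg fun ω => sub_nonneg.2 (Real.one_le_cosh _))
    (h.integral_cosh_le.trans (le_max_left _ _)) (fun n => ?_) n
  · have hLp := (h.memLp_iterate hα0 hα γ n).1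
    calc _ ≤ ∫ ω, 2 / θ ^ 2 * (Real.cosh (θ * ((iterate α γ p₀ X n ω).1 - ξ)) - 1) ∂P := by
          refine integral_mono (hLp.sub (memLp_const ξ)).integrable_sq
            (((hi n).sub (integrable_const 1)).const_mul _) fun ω => ?_
          have h1 := sq_le_cosh (θ * ((iterate α γ p₀ X n ω).1 - ξ))
          have h2 : 0 ≤ 2 / θ ^ 2 := by positivity
          refine le_trans (le_of_eq ?_) (mul_le_mul_of_nonneg_left h1 h2)
          field_simp
      _ = 2 / θ ^ 2 * ∫ ω, (Real.cosh (θ * ((iterate α γ p₀ X n ω).1 - ξ)) - 1) ∂P :=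
          integral_const_mul _ _
      _ ≤ 2 / θ ^ 2 * (C * ((n : ℝ) + 1) ^ (-β)) := by gcongr
      _ = _ := by ring
  · have hn0 : (0 : ℝ) < (n : ℝ) + 1 := by positivity
    have hρ0 := Real.rpow_pos_of_pos hn0 (-β)
    have hρ1 : ((n : ℝ) + 1) ^ (-β) ≤ 1 :=
      Real.rpow_le_one_of_one_le_of_nonpos (by linarith [Nat.cast_nonneg (α := ℝ) n])
        (by linarith)
    have hγe : γ (n + 1) = γ₁ * ((n : ℝ) + 1) ^ (-β) := learningRate_succ _ _ _
    have := h.integral_cosh_succ_le hα0 hα hθ.le (γ := γ) (c := γ₁) (n := n)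
      (by rw [hγe]; positivity) (by rw [hγe]; exact mul_le_of_le_one_right hγ₁.le hρ1)
    rw [← hD, hγe] at this
    refine this.trans ?_
    have hW : 0 ≤ ∫ ω, (Real.cosh (θ * ((iterate α γ p₀ X n ω).1 - ξ)) - 1) ∂P :=
      integral_nonneg fun ω => sub_nonneg.2 (Real.one_le_cosh _)
    set a := γ₁ * ((n : ℝ) + 1) ^ (-β) with ha
    have ha0 : 0 ≤ a := by positivity
    refine add_le_add ?_ ?_
    · gcongr
      exact le_mul_of_one_le_right hD0 (by linarith)
    · calc D * a ^ 2 = D * γ₁ * a * ((n : ℝ) + 1) ^ (-β) := by rw [sq]; nth_rw 2 [ha]; ring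
        _ ≤ _ := by gcongr; linarith

/-- The first step has size 1 and erases the initial `χ`; hence the rate starts at `n = 1` and needs
no uniform bound on the second moment of the initial value. -/
theorem exists_rate_snd [IsProbabilityMeasure P] (hα0 : 0 < α) (hα : α < 1) (hB : 0 ≤ B)
    {β : ℝ} (hβ : 0 < β) (hβ1 : β ≤ 1) {C : ℝ} (hC0 : 0 ≤ C) :
    ∃ C', 0 ≤ C' ∧ ∀ (γ : ℕ → ℝ) (p₀ : Ω → ℝ × ℝ) (X : ℕ → Ω → ℝ) (μ : Measure ℝ) (f : ℝ → ℝ)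
      (ξ : ℝ), IsModel P α θ lam B p₀ X μ f ξ →
        (∀ n : ℕ, ∫ ω, ((iterate α γ p₀ X n ω).1 - ξ) ^ 2 ∂P ≤ C * ((n : ℝ) + 1) ^ (-β)) →
        ∀ n : ℕ, n ≠ 0 → ∫ ω, ((iterate α γ p₀ X n ω).2 - V α μ ξ) ^ 2 ∂P
          ≤ C' * ((n : ℝ) + 1) ^ (-β) := by
  have h0 : 0 < 1 - α := by linarith
  set k' := 1 + 1 / (1 - α) with hk'
  -- The rate is `3/2` because `(1 - s)² (1 + s/2) = 1 - (3/2) s + s³/2`; it exceeds `β ≤ 1`. The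
  -- bound 0 on the initial term is legitimate as the recursion is applied to the sequence with its
  -- term of index 0 replaced by 0.
  obtain ⟨C', hC'0, hC'⟩ := exists_bound_of_recursion (a₁ := 1) (b := 1) (lam := 3 / 2)
    one_pos one_pos (by norm_num) hβ hβ1 (Or.inr ⟨rfl, by linarith⟩)
    (1 + (3 * kα α ^ 2 + 2 * k' ^ 2) * C + 2 * B) 0 (by positivity) le_rfl
  refine ⟨C', hC'0, fun γ p₀ X μ f ξ h hfst n hn => ?_⟩
  set y : ℕ → ℝ := fun n => ∫ ω, ((iterate α γ p₀ X n ω).2 - V α μ ξ) ^ 2 ∂P with hy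
  have hy0 : ∀ n, 0 ≤ y n := fun n => integral_nonneg fun ω => sq_nonneg _
  have := hC' (fun n => if n = 0 then 0 else y n)
    (fun n => by split_ifs; exacts [le_rfl, hy0 n]) (by simp) (fun n => ?_) n
  · simpa [hn] using this
  · have hn0 : (0 : ℝ) < (n : ℝ) + 1 := by positivity
    have hn1 : (1 : ℝ) ≤ (n : ℝ) + 1 := by linarith [Nat.cast_nonneg (α := ℝ) n]
    set ρ := ((n : ℝ) + 1) ^ (-β) with hρ
    have hρ0 : 0 < ρ := Real.rpow_pos_of_pos hn0 _
    have hs : 1 * ((n : ℝ) + 1) ^ (-1 : ℝ) = 1 / ((n : ℝ) + 1) := by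
      rw [Real.rpow_neg_one, one_mul, one_div]
    rw [hs]
    have hρs : 1 / ((n : ℝ) + 1) ≤ ρ := by
      rw [one_div, ← Real.rpow_neg_one]
      exact Real.rpow_le_rpow_of_exponent_le hn1 (by linarith)
    have hstep := h.integral_sq_succ_le hα0 hα γ n rfl
    have hs1 : 1 / ((n : ℝ) + 1) ≤ 1 := (div_le_one hn0).2 hn1
    have hs0 : 0 < 1 / ((n : ℝ) + 1) := by positivity
    have hsn : n = 0 → 1 / ((n : ℝ) + 1) = 1 := by rintro rfl; simp
    generalize 1 / ((n : ℝ) + 1) = s at *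
    rw [if_neg (Nat.succ_ne_zero n)]
    refine hstep.trans ?_
    have hss : s ^ 2 ≤ s * ρ := by rw [sq]; gcongr
    have h1 : (1 - s) ^ 2 * (1 + s / 2) * y n
        ≤ (1 - 3 / 2 * s + (1 + (3 * kα α ^ 2 + 2 * k' ^ 2) * C + 2 * B) * s ^ 2)
          * (if n = 0 then 0 else y n) := by
      split_ifs with hn'
      · rw [hsn hn']; simp
      · refine mul_le_mul_of_nonneg_right ?_ (hy0 n)
        have h2 : 0 ≤ ((3 * kα α ^ 2 + 2 * k' ^ 2) * C + 2 * B) * s ^ 2 := by positivity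
        nlinarith [mul_nonneg hs0.le (mul_nonneg hs0.le (sub_nonneg.2 hs1))]
    have h2 : (3 * s * kα α ^ 2 + 2 * s ^ 2 * k' ^ 2)
        * ∫ ω, ((iterate α γ p₀ X n ω).1 - ξ) ^ 2 ∂P
          ≤ (3 * s * kα α ^ 2 + 2 * s * k' ^ 2) * (C * ρ) := by
      have : s ^ 2 ≤ s := by rw [sq]; exact mul_le_of_le_one_right hs0.le hs1
      gcongr
      exact hfst n
    have h3 : 2 * s ^ 2 * B ≤ 2 * (s * ρ) * B := by gcongr
    have h4 : 0 ≤ s * ρ := by positivity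
    linarith

end Rates

/-! ### The laws of the losses -/

section Laws

variable {Ω : Type*} [MeasurableSpace Ω] {P : Measure Ω}
  {E F : Type} [MeasurableSpace E] [MeasurableSpace F] {Y : Ω → E} {Z : Ω → F}
  {φ : E × F → ℝ}

theorem measurable_simLoss (hφ : Measurable φ) (K : ℕ) : Measurable (simLoss φ K) := by
  unfold simLoss
  fun_prop

theorem lossLaw_eq_map_simLoss {K : ℕ} (hK : 1 ≤ K) :
    lossLaw P Y Z φ K = (sampleLaw P Y Z K).map (simLoss φ K) := by
  obtain ⟨K, rfl⟩ := Nat.exists_eq_add_of_le' hK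
  rfl

variable [IsProbabilityMeasure P]

/-- Each pair of the outer draw with one inner draw is distributed as `(Y, Z)`, so moments of `φ`
transfer. -/
theorem measurePreserving_sampleLaw (hY : Measurable Y) (hZ : Measurable Z)
    (hYZ : IndepFun Y Z P) {K : ℕ} (k : Fin K) :
    MeasurePreserving (fun s : E × (Fin K → F) => (s.1, s.2 k)) (sampleLaw P Y Z K)
      (P.map fun ω => (Y ω, Z ω)) := by
  have := Measure.isProbabilityMeasure_map (μ := P) hY.aemeasurable
  have := Measure.isProbabilityMeasure_map (μ := P) hZ.aemeasurable
  rw [(indepFun_iff_map_prod_eq_prod_map_map hY.aemeasurable hZ.aemeasurable).1 hYZ]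
  exact (MeasurePreserving.id (P.map Y)).prod (measurePreserving_eval (fun _ => P.map Z) k)

theorem isProbabilityMeasure_sampleLaw (hY : Measurable Y) (hZ : Measurable Z) (K : ℕ) :
    IsProbabilityMeasure (sampleLaw P Y Z K) := by
  have := Measure.isProbabilityMeasure_map (μ := P) hY.aemeasurable
  have := Measure.isProbabilityMeasure_map (μ := P) hZ.aemeasurable
  unfold sampleLaw; infer_instance

theorem memLp_comp_sample (hY : Measurable Y) (hZ : Measurable Z) (hYZ : IndepFun Y Z P)
    (hφ : Measurable φ) (hφ2 : MemLp (fun ω => φ (Y ω, Z ω)) 2 P) {K : ℕ} (k : Fin K) :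
    MemLp (fun s : E × (Fin K → F) => φ (s.1, s.2 k)) 2 (sampleLaw P Y Z K) := by
  have h : MemLp φ 2 (P.map fun ω => (Y ω, Z ω)) :=
    (memLp_map_measure_iff hφ.aestronglyMeasurable (hY.prodMk hZ).aemeasurable).2 hφ2
  exact h.comp_measurePreserving (measurePreserving_sampleLaw hY hZ hYZ k)

theorem integral_sq_comp_sample (hY : Measurable Y) (hZ : Measurable Z) (hYZ : IndepFun Y Z P)
    (hφ : Measurable φ) {K : ℕ} (k : Fin K) :
    ∫ s, φ (s.1, s.2 k) ^ 2 ∂(sampleLaw P Y Z K) = ∫ ω, φ (Y ω, Z ω) ^ 2 ∂P := by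
  have h := measurePreserving_sampleLaw hY hZ hYZ k
  have h2 : Measurable fun p => φ p ^ 2 := hφ.pow_const 2
  rw [← integral_map (f := fun p => φ p ^ 2) (hY.prodMk hZ).aemeasurable h2.aestronglyMeasurable,
    ← h.map_eq, integral_map h.measurable.aemeasurable h2.aestronglyMeasurable]

theorem memLp_simLoss (hY : Measurable Y) (hZ : Measurable Z) (hYZ : IndepFun Y Z P)
    (hφ : Measurable φ) (hφ2 : MemLp (fun ω => φ (Y ω, Z ω)) 2 P) (K : ℕ) :
    MemLp (simLoss φ K) 2 (sampleLaw P Y Z K) :=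
  (memLp_finsetSum _ fun k _ => memLp_comp_sample hY hZ hYZ hφ hφ2 k).const_mul _

theorem isProbabilityMeasure_lossLaw (hY : Measurable Y) (hZ : Measurable Z) (hφ : Measurable φ)
    (K : ℕ) : IsProbabilityMeasure (lossLaw P Y Z φ K) := by
  rcases Nat.eq_zero_or_pos K with rfl | hK
  · exact Measure.isProbabilityMeasure_map
      (stronglyMeasurable_condExp.mono hY.comap_le).measurable.aemeasurable
  · have := isProbabilityMeasure_sampleLaw (P := P) hY hZ K
    rw [lossLaw_eq_map_simLoss hK]
    exact Measure.isProbabilityMeasure_map (measurable_simLoss hφ K).aemeasurable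

theorem memLp_lossLaw (hY : Measurable Y) (hZ : Measurable Z) (hYZ : IndepFun Y Z P)
    (hφ : Measurable φ) (hφ2 : MemLp (fun ω => φ (Y ω, Z ω)) 2 P) (K : ℕ) :
    MemLp id 2 (lossLaw P Y Z φ K) := by
  rcases Nat.eq_zero_or_pos K with rfl | hK
  · exact (memLp_map_measure_iff aestronglyMeasurable_id
      (stronglyMeasurable_condExp.mono hY.comap_le).measurable.aemeasurable).2
      (hφ2.condExp one_le_two)
  · rw [lossLaw_eq_map_simLoss hK]
    exact (memLp_map_measure_iff aestronglyMeasurable_id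
      (measurable_simLoss hφ K).aemeasurable).2 (memLp_simLoss hY hZ hYZ hφ hφ2 K)

/-- The square of a mean is at most the mean of the squares; the resulting bound does not depend on
`K`. -/
theorem integral_sq_lossLaw_le (hY : Measurable Y) (hZ : Measurable Z) (hYZ : IndepFun Y Z P)
    (hφ : Measurable φ) (hφ2 : MemLp (fun ω => φ (Y ω, Z ω)) 2 P) {K : ℕ} (hK : 1 ≤ K) :
    ∫ x, x ^ 2 ∂(lossLaw P Y Z φ K) ≤ ∫ ω, φ (Y ω, Z ω) ^ 2 ∂P := by
  have hK0 : (0 : ℝ) < K := by exact_mod_cast hK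
  have hi : ∀ k ∈ Finset.univ, Integrable (fun s : E × (Fin K → F) => φ (s.1, s.2 k) ^ 2)
      (sampleLaw P Y Z K) := fun k _ => (memLp_comp_sample hY hZ hYZ hφ hφ2 k).integrable_sq
  rw [lossLaw_eq_map_simLoss hK, integral_map (measurable_simLoss hφ K).aemeasurable
    (by fun_prop)]
  have hpt : ∀ s : E × (Fin K → F), simLoss φ K s ^ 2
      ≤ (1 / (K : ℝ)) * ∑ k, φ (s.1, s.2 k) ^ 2 := fun s => by
    have := sq_sum_le_card_mul_sum_sq (s := Finset.univ) (f := fun k => φ (s.1, s.2 k))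
    rw [Finset.card_univ, Fintype.card_fin] at this
    unfold simLoss
    rw [mul_pow]
    calc _ ≤ (1 / (K : ℝ)) ^ 2 * (K * ∑ k, φ (s.1, s.2 k) ^ 2) := by gcongr
      _ = _ := by field_simp
  refine (integral_mono (memLp_simLoss hY hZ hYZ hφ hφ2 K).integrable_sq
    ((integrable_finsetSum _ hi).const_mul _) hpt).trans (le_of_eq ?_)
  rw [integral_const_mul, integral_finsetSum _ hi]
  simp only [integral_sq_comp_sample hY hZ hYZ hφ, Finset.sum_const, Finset.card_univ,
    Fintype.card_fin, nsmul_eq_mul]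
  field_simp

end Laws

/-! ### Variance of `psi` and the tail formula for the expected excess. -/

section Moments

variable {α : ℝ} {μ : Measure ℝ} [IsProbabilityMeasure μ]

/-- The left side is the variance of `(x - ξ)⁺ / (1 - α)`, at most its second moment. -/
theorem integral_psi_sub_sq_le (hα : α < 1) (hμ : MemLp id 2 μ) (ξ : ℝ) :
    ∫ x, (psi α ξ x - V α μ ξ) ^ 2 ∂μ
      ≤ (1 / (1 - α)) ^ 2 * (2 * ∫ x, x ^ 2 ∂μ + 2 * ξ ^ 2) := by
  have hμ1 : Integrable id μ := hμ.integrable one_le_two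
  have hx2 : Integrable (fun x : ℝ => x ^ 2) μ := hμ.integrable_sq
  set Zf : ℝ → ℝ := fun x => (1 / (1 - α)) * max (x - ξ) 0 with hZf
  have hZL : MemLp Zf 2 μ := ((hμ.sub (memLp_const ξ)).pos_part).const_mul _
  have hm : ∫ x, Zf x ∂μ = V α μ ξ - ξ := by
    rw [hZf, integral_const_mul, V]; ring
  have h1 : ∫ x, (psi α ξ x - V α μ ξ) ^ 2 ∂μ = variance Zf μ := by
    rw [variance_eq_integral hZL.aestronglyMeasurable.aemeasurable, hm]
    congr 1; funext x
    simp only [psi, hZf]; ring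
  rw [h1]
  refine (variance_le_expectation_sq hZL.aestronglyMeasurable).trans ?_
  have hpt : ∀ x, Zf x ^ 2 ≤ (1 / (1 - α)) ^ 2 * (2 * x ^ 2 + 2 * ξ ^ 2) := fun x => by
    rw [hZf, mul_pow]
    gcongr
    have : (max (x - ξ) 0) ^ 2 ≤ (x - ξ) ^ 2 := by
      rw [← sq_abs (x - ξ)]
      gcongr
      exact max_le (le_abs_self _) (abs_nonneg _)
    nlinarith [sq_nonneg (x + ξ)]
  have hi1 : Integrable (fun x : ℝ => 2 * x ^ 2) μ := hx2.const_mul 2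
  have hi2 : Integrable (fun x : ℝ => 2 * x ^ 2 + 2 * ξ ^ 2) μ := hi1.add (integrable_const _)
  calc ∫ x, (Zf ^ 2) x ∂μ ≤ ∫ x, (1 / (1 - α)) ^ 2 * (2 * x ^ 2 + 2 * ξ ^ 2) ∂μ :=
        integral_mono hZL.integrable_sq (hi2.const_mul _) hpt
    _ = _ := by
        rw [integral_const_mul, integral_add hi1 (integrable_const _), integral_const_mul]
        simp

/-- Layer cake formula followed by a translation by `ξ`. It turns the expansion of the distribution
functions into one of `V`. -/
theorem integral_max_sub (hμ : Integrable id μ) (ξ : ℝ) :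
    IntegrableOn (fun t => 1 - μ.real (Set.Iic t)) (Set.Ioi ξ) ∧
      ∫ x, max (x - ξ) 0 ∂μ = ∫ t in Set.Ioi ξ, (1 - μ.real (Set.Iic t)) := by
  have hf := integrable_max_sub hμ ξ
  have hnn : 0 ≤ᵐ[μ] fun x => max (x - ξ) 0 := Eventually.of_forall fun x => le_max_right _ _
  have hmp := measurePreserving_add_left (volume : Measure ℝ) ξ
  have hemb : MeasurableEmbedding (fun t : ℝ => ξ + t) := measurableEmbedding_addLeft ξ
  have hpre : (fun t : ℝ => ξ + t) ⁻¹' Set.Ioi ξ = Set.Ioi 0 := by ext t; simp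
  have hset : ∀ t ∈ Set.Ioi (0 : ℝ), {x : ℝ | t < max (x - ξ) 0} = Set.Ioi (ξ + t) := by
    intro t ht
    have ht' : 0 < t := ht
    ext x
    simp only [Set.mem_ofPred_eq, Set.mem_Ioi, lt_max_iff]
    constructor
    · rintro (h | h) <;> linarith
    · intro h; left; linarith
  have hreal : ∀ t ∈ Set.Ioi (0 : ℝ), μ.real {x : ℝ | t < max (x - ξ) 0}
      = 1 - μ.real (Set.Iic (ξ + t)) := fun t ht => by
    rw [hset t ht, measureReal_Ioi]
  constructor
  · rw [← hmp.integrableOn_comp_preimage hemb, hpre]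
    have h1 : IntegrableOn (fun t => μ.real {x : ℝ | t < max (x - ξ) 0}) (Set.Ioi 0) := by
      have hanti : Antitone fun t => μ {x : ℝ | t < max (x - ξ) 0} := fun a b hab =>
        measure_mono fun x (hx : b < _) => lt_of_le_of_lt hab hx
      refine integrable_toReal_of_lintegral_ne_top hanti.measurable.aemeasurable ?_
      rw [← lintegral_eq_lintegral_meas_lt μ hnn hf.aemeasurable]
      exact hf.lintegral_lt_top.ne
    exact h1.congr_fun hreal measurableSet_Ioi
  · rw [hf.integral_eq_integral_meas_lt hnn, setIntegral_congr_fun measurableSet_Ioi hreal,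
      ← hmp.setIntegral_preimage_emb hemb (fun t => 1 - μ.real (Set.Iic t)), hpre]

end Moments

/-! ### The bias and the constant `lambdaBar` -/

section Bias

variable {α : ℝ} {μ : ℕ → Measure ℝ} [∀ K, IsProbabilityMeasure (μ K)] {f : ℕ → ℝ → ℝ}
  {ξs : ℕ → ℝ}

theorem bias_pos {K : ℕ} (hK : 1 ≤ K) : 0 < bias K := by
  have : (0 : ℝ) < K := by exact_mod_cast hK
  unfold bias; positivity

theorem bias_le_one (K : ℕ) : bias K ≤ 1 := Nat.cast_inv_le_one K

/-- The finitely many exceptional indices are absorbed by the constant, as `i * |u i|` is `|u i| /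
bias i` for `i ≥ 1`. -/
theorem exists_abs_le_mul_bias {u : ℕ → ℝ} {C : ℝ} (h : ∀ᶠ K in atTop, |u K| ≤ C * bias K) :
    ∃ C', 0 ≤ C' ∧ ∀ K, 1 ≤ K → |u K| ≤ C' * bias K := by
  obtain ⟨N, hN⟩ := eventually_atTop.1 h
  refine ⟨|C| + ∑ i ∈ Finset.range N, (i : ℝ) * |u i|, by positivity, fun K hK => ?_⟩
  have hb := bias_pos hK
  have hs : 0 ≤ ∑ i ∈ Finset.range N, (i : ℝ) * |u i| := by positivity
  rcases le_or_gt N K with hNK | hNK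
  · refine (hN K hNK).trans ?_
    gcongr
    linarith [le_abs_self C]
  · have h1 := Finset.single_le_sum (f := fun i : ℕ => (i : ℝ) * |u i|)
      (fun i _ => by positivity) (Finset.mem_range.2 hNK)
    have hK0 : (0 : ℝ) < K := by exact_mod_cast hK
    calc |u K| = ((K : ℝ) * |u K|) * bias K := by unfold bias; field_simp
      _ ≤ _ := by
        gcongr
        exact h1.trans (le_add_of_nonneg_left (abs_nonneg C))

theorem IsContinuousPdf.mul_sub_le {ν : Measure ℝ} [IsProbabilityMeasure ν] {g : ℝ → ℝ}
    (hg : IsContinuousPdf ν g) {a b c : ℝ} (hab : a ≤ b) (hc : ∀ x ∈ Set.Icc a b, c ≤ g x) :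
    c * (b - a) ≤ ν.real (Set.Iic b) - ν.real (Set.Iic a) := by
  rw [hg.measureReal_Iic_sub]
  have := intervalIntegral.integral_mono_on (μ := volume) hab (intervalIntegrable_const (c := c))
    (hg.continuous.intervalIntegrable a b) hc
  rw [intervalIntegral.integral_const, smul_eq_mul, mul_comm] at this
  exact this

/-- The distribution function grows at rate at least `c` inside the unit ball and is monotone
outside. The truncation at `1/2` allows for a `ζ` not yet known to be close to `ξ`. -/
theorem IsContinuousPdf.mul_min_le {ν : Measure ℝ} [IsProbabilityMeasure ν] {g : ℝ → ℝ}
    (hg : IsContinuousPdf ν g) {ξ c : ℝ} (hc : ∀ x ∈ Metric.ball ξ 1, c ≤ g x)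
    (ζ : ℝ) :
    c * min (1 / 2) |ζ - ξ| ≤ |ν.real (Set.Iic ζ) - ν.real (Set.Iic ξ)| := by
  have hmono : ∀ {a b : ℝ}, a ≤ b → ν.real (Set.Iic a) ≤ ν.real (Set.Iic b) := fun h =>
    measureReal_mono (Set.Iic_subset_Iic.2 h)
  set r := min (1 / 2) |ζ - ξ| with hr
  have hr0 : 0 ≤ r := le_min (by norm_num) (abs_nonneg _)
  have hr1 : r ≤ 1 / 2 := min_le_left _ _
  have hr2 : r ≤ |ζ - ξ| := min_le_right _ _
  have hball : ∀ x, |x - ξ| ≤ r → c ≤ g x := fun x hx =>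
    hc x (by rw [Metric.mem_ball, Real.dist_eq]; linarith)
  rcases le_total ξ ζ with h | h
  · rw [abs_of_nonneg (sub_nonneg.2 h)] at hr2
    have h1 := hg.mul_sub_le (a := ξ) (b := ξ + r) (c := c) (by linarith) fun x hx =>
      hball x (abs_le.2 ⟨by linarith [hx.1], by linarith [hx.2]⟩)
    have h2 := hmono (show ξ + r ≤ ζ by linarith)
    rw [abs_of_nonneg (by linarith [hmono h])]
    linarith
  · rw [abs_of_nonpos (sub_nonpos.2 h)] at hr2
    have h1 := hg.mul_sub_le (a := ξ - r) (b := ξ) (c := c) (by linarith) fun x hx =>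
      hball x (abs_le.2 ⟨by linarith [hx.1], by linarith [hx.2]⟩)
    have h2 := hmono (show ζ ≤ ξ - r by linarith)
    rw [abs_of_nonpos (by linarith [hmono h])]
    linarith

/-- Both minimizers are `α`-quantiles, so `F_K(ξ_K) - F_K(ξ_0) = F_0(ξ_0) - F_K(ξ_0)`, which is
`O(h)` by the expansion. Once this is small, the truncation in `mul_min_le` is inactive. -/
theorem exists_abs_argmin_sub_le (hα : α < 1) (hμ : ∀ K, Integrable id (μ K))
    (hξs : ∀ K, ξs K ∈ argminV α (μ K)) (hexp : LossExpansion α μ f)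
    (hbounds : DensityBounds f (ξs 0)) :
    ∃ C, 0 ≤ C ∧ ∀ K, 1 ≤ K → |ξs K - ξs 0| ≤ C * bias K := by
  obtain ⟨v, w, hvw, h2⟩ := hexp.expansion
  obtain ⟨-, -, hw, -⟩ := h2 _ (hξs 0)
  obtain ⟨B, hB⟩ := hw.abs.bddAbove_range
  obtain ⟨c, hc0, hc⟩ := hbounds.lower 1 one_pos
  set D := |v (ξs 0)| + B
  have hF : ∀ K, (μ K).real (Set.Iic (ξs K)) = α := fun K => by
    have := (hexp.pdf K).nullSingletonClass
    exact measureReal_Iic_argmin hα (hμ K) (hξs K)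
  have key : ∀ K, 1 ≤ K → c * min (1 / 2) |ξs K - ξs 0| ≤ D * bias K := fun K hK => by
    have hb := bias_pos hK
    refine ((hexp.pdf K).mul_min_le (hc K) (ξs K)).trans ?_
    rw [hF K, ← hF 0, abs_sub_comm, hvw K hK, ← add_mul, abs_mul, abs_of_pos hb]
    gcongr
    exact (abs_add_le _ _).trans (by
      have : |w K (ξs 0)| ≤ B := hB ⟨K, rfl⟩
      linarith)
  have hbt : Tendsto bias atTop (𝓝 0) := tendsto_inv_atTop_nhds_zero_nat (𝕜 := ℝ)
  have hev := (hbt.const_mul D).eventually_lt_const (show D * 0 < c * (1 / 2) by simpa using hc0)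
  refine exists_abs_le_mul_bias (C := D / c) ?_
  filter_upwards [hev, eventually_ge_atTop 1] with K h1 hK
  have h3 := key K hK
  rw [div_mul_eq_mul_div, le_div_iff₀ hc0, mul_comm]
  rcases le_total (1 / 2) |ξs K - ξs 0| with h | h
  · rw [min_eq_left h] at h3; linarith
  · rwa [min_eq_right h] at h3

/-- The comparison passes through `V_h(ξ_0)`: moving the argument costs a Lipschitz constant times
`|ξ_h - ξ_0|`, and changing the law costs the integrated expansion over `(ξ_0, ∞)`. -/
theorem exists_abs_minV_sub_le (hα : α < 1) (hμ : ∀ K, Integrable id (μ K))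
    (hξs : ∀ K, ξs K ∈ argminV α (μ K)) (hexp : LossExpansion α μ f)
    (hbounds : DensityBounds f (ξs 0)) :
    ∃ C, ∀ K, 1 ≤ K → |V α (μ K) (ξs K) - V α (μ 0) (ξs 0)| ≤ C * bias K := by
  obtain ⟨C, hC0, hC⟩ := exists_abs_argmin_sub_le hα hμ hξs hexp hbounds
  obtain ⟨v, w, hvw, h2⟩ := hexp.expansion
  obtain ⟨hv, hwi, -, hw⟩ := h2 _ (hξs 0)
  obtain ⟨B, hB⟩ := hw.abs.bddAbove_range
  have h0 : 0 < 1 - α := by linarith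
  refine ⟨kα α * C + 1 / (1 - α) * (|∫ t in Set.Ioi (ξs 0), v t| + B), fun K hK => ?_⟩
  have hb := bias_pos hK
  have := (hexp.pdf K).nullSingletonClass
  have h3 : |V α (μ K) (ξs K) - V α (μ K) (ξs 0)| ≤ kα α * (C * bias K) :=
    (abs_V_sub_le hα (hμ K) _ _).trans
      (mul_le_mul_of_nonneg_left (hC K hK) (zero_le_one.trans (one_le_kα α)))
  have h4 : V α (μ 0) (ξs 0) - V α (μ K) (ξs 0) = 1 / (1 - α)
      * ((∫ t in Set.Ioi (ξs 0), v t) + ∫ t in Set.Ioi (ξs 0), w K t) * bias K := by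
    obtain ⟨hi0, he0⟩ := integral_max_sub (hμ 0) (ξs 0)
    obtain ⟨hiK, heK⟩ := integral_max_sub (hμ K) (ξs 0)
    have h5 : (∫ t in Set.Ioi (ξs 0), (1 - (μ 0).real (Set.Iic t)))
        - ∫ t in Set.Ioi (ξs 0), (1 - (μ K).real (Set.Iic t))
        = ∫ t in Set.Ioi (ξs 0), (v t + w K t) * bias K := by
      rw [← integral_sub hi0 hiK]
      congr 1; funext t
      have := hvw K hK t
      linarith
    rw [integral_mul_const, integral_add hv (hwi K hK)] at h5
    unfold V
    rw [he0, heK]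
    linear_combination (1 / (1 - α)) * h5
  have h6 : |V α (μ K) (ξs 0) - V α (μ 0) (ξs 0)|
      ≤ 1 / (1 - α) * (|∫ t in Set.Ioi (ξs 0), v t| + B) * bias K := by
    rw [abs_sub_comm, h4, abs_mul, abs_mul, abs_of_pos hb, abs_of_pos (by positivity)]
    gcongr
    exact (abs_add_le _ _).trans (by
      have : |∫ t in Set.Ioi (ξs 0), w K t| ≤ B := hB ⟨K, rfl⟩
      linarith)
  have h7 := abs_sub_le (V α (μ K) (ξs K)) (V α (μ K) (ξs 0)) (V α (μ 0) (ξs 0))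
  linarith

/-- All minimizers lie in one ball around `ξs 0`, because `bias K ≤ 1`. -/
theorem exists_density_argmin_ge (hα : α < 1) (hμ : ∀ K, Integrable id (μ K))
    (hξs : ∀ K, ξs K ∈ argminV α (μ K)) (hexp : LossExpansion α μ f)
    (hbounds : DensityBounds f (ξs 0)) : ∃ c > 0, ∀ K, c ≤ f K (ξs K) := by
  obtain ⟨C, hC0, hC⟩ := exists_abs_argmin_sub_le hα hμ hξs hexp hbounds
  obtain ⟨c, hc0, hc⟩ := hbounds.lower (C + 1) (by positivity)
  refine ⟨c, hc0, fun K => hc K _ ?_⟩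
  rw [Metric.mem_ball, Real.dist_eq]
  rcases Nat.eq_zero_or_pos K with rfl | hK
  · simp; positivity
  · have := mul_le_mul_of_nonneg_left (bias_le_one K) hC0
    linarith [hC K hK]

theorem lambdaBarOf_nonneg (hα : α < 1) (hμ : ∀ K, Integrable id (μ K))
    (hexp : LossExpansion α μ f) (q K : ℕ) (ξ : ℝ) : 0 ≤ lambdaBarOf q α (μ K) ξ := by
  have h0 : 0 < 1 - α := by linarith
  have hV := (hexp.pdf K).V''_eq hα (hμ K)
  have hp : 0 ≤ V'' α (μ K) ξ := by
    rw [hV]; exact mul_nonneg (by positivity) ((hexp.pdf K).nonneg ξ)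
  have := supNorm_nonneg (V'' α (μ K))
  unfold lambdaBarOf
  exact le_min (by positivity) (by positivity)

theorem lambdaBar_le (hα : α < 1) (hμ : ∀ K, Integrable id (μ K))
    (hexp : LossExpansion α μ f) (q K : ℕ) : lambdaBar q α μ ξs ≤ lambdaBarOf q α (μ K) (ξs K) :=
  ciInf_le (f := fun K => lambdaBarOf q α (μ K) (ξs K))
    ⟨0, by rintro _ ⟨K, rfl⟩; exact lambdaBarOf_nonneg hα hμ hexp q K _⟩ K

/-- Every ingredient is bounded uniformly in `K`: `V''` at the minimizer and its supremum norm from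
below by `c'`, the Lipschitz seminorm from above by `L'`. -/
theorem lambdaBar_pos (hα : α < 1) (hμ : ∀ K, Integrable id (μ K))
    (hξs : ∀ K, ξs K ∈ argminV α (μ K)) (hexp : LossExpansion α μ f)
    (hbounds : DensityBounds f (ξs 0)) : 0 < lambdaBar 1 α μ ξs := by
  obtain ⟨c, hc0, hc⟩ := exists_density_argmin_ge hα hμ hξs hexp hbounds
  obtain ⟨L, hL⟩ := hbounds.lipschitz
  obtain ⟨M, hM⟩ := hbounds.upper
  have h0 : 0 < 1 / (1 - α) := by have : 0 < 1 - α := by linarith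
                                  positivity
  set c' := 1 / (1 - α) * c with hc'
  have hc'0 : 0 < c' := by positivity
  set L' : NNReal := Real.toNNReal (1 / (1 - α)) * L
  have hlip : ∀ K, LipschitzWith L' (V'' α (μ K)) := fun K =>
    (hexp.pdf K).lipschitz_V'' hα (hμ K) (hL K)
  have hlip0 : ∀ K, 0 < lipSeminorm (V'' α (μ K)) := fun K =>
    (hexp.pdf K).lipSeminorm_V''_pos hα (hμ K) (hL K) (hc0.trans_le (hc K))
  have hL'0 : (0 : ℝ) < L' := (hlip0 0).trans_le (lipSeminorm_le (hlip 0))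
  have hV : ∀ K, c' ≤ V'' α (μ K) (ξs K) := fun K => by
    rw [(hexp.pdf K).V''_eq hα (hμ K)]
    exact mul_le_mul_of_nonneg_left (hc K) h0.le
  have hsup : ∀ K, c' ≤ supNorm (V'' α (μ K)) := fun K => by
    refine (hV K).trans ((le_abs_self _).trans (le_supNorm (M := 1 / (1 - α) * M) (fun x => ?_) _))
    rw [(hexp.pdf K).V''_eq hα (hμ K), abs_mul, abs_of_pos h0]
    exact mul_le_mul_of_nonneg_left (hM K x) h0.le
  have hpos : 0 < min (3 / 8 * c') (c' * (c' ^ 4 / (4 * (L' : ℝ) ^ 2))) := by positivity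
  refine hpos.trans_le (le_ciInf fun K => ?_)
  have h1 := hV K
  have h2 := hsup K
  have h3 := lipSeminorm_le (hlip K)
  have h4 := hlip0 K
  unfold lambdaBarOf
  simp only [Nat.cast_one, one_pow, mul_one, one_mul]
  have h5 := hc'0.trans_le h1
  have h6 := hc'0.trans_le h2
  refine min_le_min (by gcongr) ?_
  gcongr

theorem bddAbove_supNorm (hbounds : DensityBounds f (ξs 0)) :
    BddAbove (Set.range fun J => supNorm (f J)) := by
  obtain ⟨M, hM⟩ := hbounds.upper
  exact ⟨M, by rintro _ ⟨J, rfl⟩; exact supNorm_le (hM J)⟩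

theorem supNorm_le_iSup (hbounds : DensityBounds f (ξs 0)) (K : ℕ) :
    supNorm (f K) ≤ ⨆ J, supNorm (f J) :=
  le_ciSup (f := fun J => supNorm (f J)) (bddAbove_supNorm hbounds) K

theorem iSup_supNorm_pos (hbounds : DensityBounds f (ξs 0)) : 0 < ⨆ J, supNorm (f J) := by
  obtain ⟨M, hM⟩ := hbounds.upper
  obtain ⟨c, hc0, hc⟩ := hbounds.lower 1 one_pos
  have h1 := hc 0 (ξs 0) (Metric.mem_ball_self one_pos)
  exact (hc0.trans_le (h1.trans ((le_abs_self _).trans (le_supNorm (hM 0) _)))).trans_le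
    (supNorm_le_iSup hbounds 0)

end Bias

/-! ### Moments of the initial value, and passage from mean square to mean absolute errors. -/

section Initial

/-- Bounds the initial Lyapunov value by the assumed exponential moment. The weight `|x|²` is
harmless: it is at least 1 for `|x| ≥ 1`, and for `|x| ≤ 1` the exponential is at most `exp a`. -/
theorem cosh_mul_sub_le {θ a R x ξ : ℝ} (hθ : 0 ≤ θ) (ha : θ ≤ a) (hξ : |ξ| ≤ R) :
    Real.cosh (θ * (x - ξ))
      ≤ Real.exp (θ * R) * (Real.exp a + |x| ^ 2 * Real.exp (a * |x|)) := by
  have h1 : Real.cosh (θ * (x - ξ)) ≤ Real.exp (θ * R) * Real.exp (a * |x|) := by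
    rw [← Real.exp_add, ← Real.cosh_abs]
    have h2 : Real.cosh |θ * (x - ξ)| ≤ Real.exp |θ * (x - ξ)| := by
      rw [← Real.cosh_add_sinh]
      linarith [Real.sinh_nonneg_iff.2 (abs_nonneg (θ * (x - ξ)))]
    refine h2.trans (Real.exp_le_exp.2 ?_)
    rw [abs_mul, abs_of_nonneg hθ]
    calc θ * |x - ξ| ≤ θ * (|x| + R) := by
          gcongr
          exact (abs_sub _ _).trans (by linarith)
      _ = θ * R + θ * |x| := by ring
      _ ≤ _ := by gcongr
  refine h1.trans ?_
  gcongr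
  have ha0 : 0 ≤ a := hθ.trans ha
  rcases le_total |x| 1 with h | h
  · have : Real.exp (a * |x|) ≤ Real.exp a :=
      Real.exp_le_exp.2 (mul_le_of_le_one_right ha0 h)
    have : 0 ≤ |x| ^ 2 * Real.exp (a * |x|) := by positivity
    linarith
  · have : Real.exp (a * |x|) ≤ |x| ^ 2 * Real.exp (a * |x|) :=
      le_mul_of_one_le_left (Real.exp_pos _).le (one_le_pow₀ h)
    linarith [Real.exp_pos a]

/-- Pointwise, `|T - a| ≤ (T - a)² / (2ε) + ε / 2`; the bias `D ε` is added by the triangle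
inequality. -/
theorem integral_abs_sub_le {Ω : Type*} [MeasurableSpace Ω] {P : Measure Ω}
    [IsProbabilityMeasure P] {T : Ω → ℝ} (hT : MemLp T 2 P) {a b C D ε : ℝ} (hε : 0 < ε)
    (h : ∫ ω, (T ω - a) ^ 2 ∂P ≤ C * ε ^ 2) (hab : |a - b| ≤ D * ε) :
    ∫ ω, |T ω - b| ∂P ≤ ((C + 1) / 2 + D) * ε := by
  have hi : Integrable (fun ω => (T ω - a) ^ 2) P := (hT.sub (memLp_const a)).integrable_sq
  have hi2 := hi.const_mul (1 / (2 * ε))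
  have hpt : ∀ ω, |T ω - b| ≤ 1 / (2 * ε) * (T ω - a) ^ 2 + (ε / 2 + D * ε) := fun ω => by
    have h1 : |T ω - a| ≤ 1 / (2 * ε) * (T ω - a) ^ 2 + ε / 2 := by
      rw [← sq_abs]
      have : 0 ≤ (|T ω - a| - ε) ^ 2 / (2 * ε) := by positivity
      have h2 : (|T ω - a| - ε) ^ 2 / (2 * ε)
          = 1 / (2 * ε) * |T ω - a| ^ 2 + ε / 2 - |T ω - a| := by field_simp; ring
      linarith
    linarith [abs_sub_le (T ω) a b]
  calc _ ≤ ∫ ω, (1 / (2 * ε) * (T ω - a) ^ 2 + (ε / 2 + D * ε)) ∂P :=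
        integral_mono ((hT.sub (memLp_const b)).integrable one_le_two).abs
          (hi2.add (integrable_const _)) hpt
    _ = 1 / (2 * ε) * ∫ ω, (T ω - a) ^ 2 ∂P + (ε / 2 + D * ε) := by
        rw [integral_add hi2 (integrable_const _), integral_const_mul]; simp
    _ ≤ 1 / (2 * ε) * (C * ε ^ 2) + (ε / 2 + D * ε) := by gcongr
    _ = _ := by field_simp; ring

theorem rpow_tunedN_le {β ε : ℝ} (hβ : 0 < β) (hε : 0 < ε) :
    ((tunedN β ε : ℝ) + 1) ^ (-β) ≤ ε ^ 2 := by
  have h1 : ε ^ (-(2 / β)) ≤ (tunedN β ε : ℝ) + 1 := (rpow_le_tunedN β ε).trans (by linarith)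
  refine (Real.rpow_le_rpow_of_nonpos (Real.rpow_pos_of_pos hε _) h1 (by linarith)).trans
    (le_of_eq ?_)
  rw [← Real.rpow_mul hε.le, show -(2 / β) * -β = ((2 : ℕ) : ℝ) by push_cast; field_simp,
    Real.rpow_natCast]

end Initial

/-! ### The error of the tuned algorithm -/

section Error

variable {Ω : Type*} [MeasurableSpace Ω] {P : Measure Ω}
  {E F : Type} [MeasurableSpace E] [MeasurableSpace F] {Y : Ω → E} {Z : Ω → F}
  {φ : E × F → ℝ} {α : ℝ} {f : ℕ → ℝ → ℝ} {ξs : ℕ → ℝ} {ξ0 χ0 : ℕ → Ω → ℝ}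
  {S : (K : ℕ) → ℕ → Ω → E × (Fin K → F)}

theorem IsInput.isDriven (hS : IsInput P Y Z ξ0 χ0 S) (hφ : Measurable φ) {K : ℕ} (hK : 1 ≤ K) :
    IsDriven P (fun ω => (ξ0 K ω, χ0 K ω)) (fun n ω => simLoss φ K (S K n ω))
      (lossLaw P Y Z φ K) where
  measurable_init := (hS.measurable_ξ0 K hK).prodMk (hS.measurable_χ0 K hK)
  measurable_loss n := (measurable_simLoss hφ K).comp (hS.measurable_S K hK n)
  map_loss n := by
    rw [lossLaw_eq_map_simLoss hK, ← hS.map_S K hK n,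
      Measure.map_map (measurable_simLoss hφ K) (hS.measurable_S K hK n)]
    rfl
  iIndepFun_loss := (hS.iIndepFun_S K hK).comp (fun _ => simLoss φ K)
    fun _ => measurable_simLoss hφ K
  indepFun_init := by
    have hm : Measurable fun (s : ℕ → E × (Fin K → F)) n => simLoss φ K (s n) :=
      measurable_pi_lambda _ fun n => (measurable_simLoss hφ K).comp (measurable_pi_apply n)
    exact (hS.indepFun_init K hK).comp measurable_id hm

variable [IsProbabilityMeasure P]

/-- The parameters `θ`, `lam` and `B` are the same for all `K`; this is the source of the uniformity
in `h` of the rates. -/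
theorem exists_isModel (hY : Measurable Y) (hZ : Measurable Z) (hYZ : IndepFun Y Z P)
    (hφ : Measurable φ) (hφ2 : MemLp (fun ω => φ (Y ω, Z ω)) 2 P) (hα0 : 0 < α) (hα1 : α < 1)
    (hξs : ∀ K, ξs K ∈ argminV α (lossLaw P Y Z φ K)) (hexp : LossExpansion α (lossLaw P Y Z φ) f)
    (hbounds : DensityBounds f (ξs 0)) (hS : IsInput P Y Z ξ0 χ0 S)
    (hinit : InitialMoments P α f ξ0 χ0) :
    ∃ B, 0 ≤ B ∧ ∀ K, 1 ≤ K →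
      IsModel P α (1 / (1 - α) * ⨆ J, supNorm (f J)) (lambdaBar 1 α (lossLaw P Y Z φ) ξs) B
        (fun ω => (ξ0 K ω, χ0 K ω)) (fun n ω => simLoss φ K (S K n ω)) (lossLaw P Y Z φ K)
        (f K) (ξs K) := by
  have hprob := isProbabilityMeasure_lossLaw (P := P) (φ := φ) hY hZ hφ
  have hLp := memLp_lossLaw hY hZ hYZ hφ hφ2
  have hint : ∀ K, Integrable id (lossLaw P Y Z φ K) := fun K => (hLp K).integrable one_le_two
  obtain ⟨c, hc0, hc⟩ := exists_density_argmin_ge hα1 hint hξs hexp hbounds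
  obtain ⟨C, hC0, hC⟩ := exists_abs_argmin_sub_le hα1 hint hξs hexp hbounds
  obtain ⟨L, hL⟩ := hbounds.lipschitz
  obtain ⟨M, hM⟩ := hinit.exp_moment
  have h0 : 0 < 1 - α := by linarith
  have hsup := iSup_supNorm_pos hbounds
  set θ := 1 / (1 - α) * ⨆ J, supNorm (f J) with hθ
  have hθ0 : 0 < θ := by positivity
  set a := 4 / (1 - α) * kα α * ⨆ J, supNorm (f J) with ha
  have hθa : θ ≤ a := by
    rw [hθ, ha]
    gcongr
    calc 1 / (1 - α) ≤ 4 / (1 - α) := by gcongr; norm_num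
      _ ≤ _ := le_mul_of_one_le_right (by positivity) (one_le_kα α)
  set R := |ξs 0| + C with hR
  have hξR : ∀ K, 1 ≤ K → |ξs K| ≤ R := fun K hK => by
    have h1 := hC K hK
    have h2 := mul_le_mul_of_nonneg_left (bias_le_one K) hC0
    have h3 := abs_sub_abs_le_abs_sub (ξs K) (ξs 0)
    linarith
  set A := ∫ ω, φ (Y ω, Z ω) ^ 2 ∂P
  have hA0 : 0 ≤ A := integral_nonneg fun ω => sq_nonneg _
  set B₁ := Real.exp (θ * R) * (Real.exp a + M) with hB₁
  set B₂ := (1 / (1 - α)) ^ 2 * (2 * A + 2 * R ^ 2) with hB₂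
  have hB₂0 : 0 ≤ B₂ := by positivity
  have hdom : ∀ K, 1 ≤ K → Integrable (fun ω => Real.exp (θ * R)
      * (Real.exp a + |ξ0 K ω| ^ 2 * Real.exp (a * |ξ0 K ω|))) P := fun K hK =>
    ((integrable_const _).add (hM K hK).1).const_mul _
  have hcosh : ∀ K, 1 ≤ K → Integrable (fun ω => Real.cosh (θ * (ξ0 K ω - ξs K))) P :=
    fun K hK => by
      refine (hdom K hK).mono' ?_ (Eventually.of_forall fun ω => ?_)
      · exact (Real.measurable_cosh.comp
          (((hS.measurable_ξ0 K hK).sub_const _).const_mul θ)).aestronglyMeasurable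
      · rw [Real.norm_eq_abs, abs_of_pos (Real.cosh_pos _)]
        exact cosh_mul_sub_le hθ0.le hθa (hξR K hK)
  refine ⟨max B₁ B₂, le_max_of_le_right hB₂0, fun K hK => ?_⟩
  exact
    { driven := hS.isDriven hφ hK
      prob := hprob K
      pdf := hexp.pdf K
      memLp := hLp K
      lipschitz := ⟨L, hL K⟩
      argmin := hξs K
      density_pos := hc0.trans_le (hc K)
      supNorm_le := mul_le_mul_of_nonneg_left (supNorm_le_iSup hbounds K) (by positivity)
      lam_le := lambdaBar_le hα1 hint hexp 1 K
      memLp_fst := hS.memLp_ξ0 K hK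
      memLp_snd := hS.memLp_χ0 K hK
      integrable_cosh := hcosh K hK
      integral_cosh_le := by
        refine le_max_of_le_left ?_
        calc _ ≤ ∫ ω, Real.exp (θ * R)
              * (Real.exp a + |ξ0 K ω| ^ 2 * Real.exp (a * |ξ0 K ω|)) ∂P := by
              refine integral_mono ((hcosh K hK).sub (integrable_const 1)) (hdom K hK)
                fun ω => ?_
              have := cosh_mul_sub_le (x := ξ0 K ω) hθ0.le hθa (hξR K hK)
              simp only
              linarith
          _ = Real.exp (θ * R) * (Real.exp a
              + ∫ ω, |ξ0 K ω| ^ 2 * Real.exp (a * |ξ0 K ω|) ∂P) := by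
              rw [integral_const_mul, integral_add (integrable_const _) (hM K hK).1]; simp
          _ ≤ B₁ := by
              rw [hB₁]
              gcongr
              exact (hM K hK).2
      variance_le := by
        refine le_max_of_le_right ((integral_psi_sub_sq_le hα1 (hLp K) (ξs K)).trans ?_)
        have h1 := integral_sq_lossLaw_le hY hZ hYZ hφ hφ2 hK
        have h2 : ξs K ^ 2 ≤ R ^ 2 := by
          rw [← sq_abs]
          exact pow_le_pow_left₀ (abs_nonneg _) (hξR K hK) 2
        rw [hB₂]
        gcongr }

theorem exists_error_le (hY : Measurable Y) (hZ : Measurable Z) (hYZ : IndepFun Y Z P)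
    (hφ : Measurable φ) (hφ2 : MemLp (fun ω => φ (Y ω, Z ω)) 2 P) (hα0 : 0 < α) (hα1 : α < 1)
    (hξs : ∀ K, ξs K ∈ argminV α (lossLaw P Y Z φ K)) (hexp : LossExpansion α (lossLaw P Y Z φ) f)
    (hbounds : DensityBounds f (ξs 0)) (hS : IsInput P Y Z ξ0 χ0 S)
    (hinit : InitialMoments P α f ξ0 χ0) (u : UnitCosts) {β γ₁ : ℝ}
    (hadm : Admissible (lambdaBar 1 α (lossLaw P Y Z φ) ξs) β γ₁) :
    ∃ C : ℝ, ∀ ε ∈ Set.Ioo (0 : ℝ) 1,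
      Integrable (fun ω => (tunedRun u φ α ξ0 χ0 S β γ₁ ε ω).val.1) P ∧
      Integrable (fun ω => (tunedRun u φ α ξ0 χ0 S β γ₁ ε ω).val.2) P ∧
      ∫ ω, |(tunedRun u φ α ξ0 χ0 S β γ₁ ε ω).val.1 - ξs 0| ∂P ≤ C * ε ∧
      ∫ ω, |(tunedRun u φ α ξ0 χ0 S β γ₁ ε ω).val.2 - V α (lossLaw P Y Z φ 0) (ξs 0)| ∂P
        ≤ C * ε := by
  have hprob := isProbabilityMeasure_lossLaw (P := P) (φ := φ) hY hZ hφ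
  have hLp := memLp_lossLaw hY hZ hYZ hφ hφ2
  have hint : ∀ K, Integrable id (lossLaw P Y Z φ K) := fun K => (hLp K).integrable one_le_two
  have hlam := lambdaBar_pos hα1 hint hξs hexp hbounds
  have h0 : 0 < 1 - α := by linarith
  have hsup := iSup_supNorm_pos hbounds
  obtain ⟨B, hB0, hmodel⟩ :=
    exists_isModel hY hZ hYZ hφ hφ2 hα0 hα1 hξs hexp hbounds hS hinit
  obtain ⟨D₁, hD₁0, hD₁⟩ := exists_abs_argmin_sub_le hα1 hint hξs hexp hbounds
  obtain ⟨D₂, hD₂⟩ := exists_abs_minV_sub_le hα1 hint hξs hexp hbounds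
  obtain ⟨C₁, hC₁0, hC₁⟩ := exists_rate_fst (P := P)
    (θ := 1 / (1 - α) * ⨆ J, supNorm (f J)) hα0 hα1 (by positivity) hlam B hadm
  obtain ⟨C₂, hC₂0, hC₂⟩ := exists_rate_snd (P := P)
    (θ := 1 / (1 - α) * ⨆ J, supNorm (f J)) (lam := lambdaBar 1 α (lossLaw P Y Z φ) ξs)
    hα0 hα1 hB0 hadm.β_pos hadm.β_le_one hC₁0
  refine ⟨max ((C₁ + 1) / 2 + D₁) ((C₂ + 1) / 2 + |D₂|), fun ε hε => ?_⟩
  have hε0 := hε.1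
  have hK := one_le_tunedK hε0
  have hN := one_le_tunedN β hε0
  have hbias := bias_tunedK_le hε0
  have hρ := rpow_tunedN_le hadm.β_pos hε0
  have hM := hmodel _ hK
  have hval : ∀ ω, (tunedRun u φ α ξ0 χ0 S β γ₁ ε ω).val
      = iterate α (learningRate γ₁ β) (fun ω => (ξ0 (tunedK ε) ω, χ0 (tunedK ε) ω))
        (fun n ω => simLoss φ (tunedK ε) (S (tunedK ε) n ω)) (tunedN β ε) ω := fun ω =>
    val_nestedSA ..
  simp only [hval]
  obtain ⟨hL1, hL2⟩ := hM.memLp_iterate hα0 hα1 (learningRate γ₁ β) (tunedN β ε)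
  refine ⟨hL1.integrable one_le_two, hL2.integrable one_le_two, ?_, ?_⟩
  · refine (integral_abs_sub_le (a := ξs (tunedK ε)) (C := C₁) (D := D₁) hL1 hε0 ?_ ?_).trans
      (mul_le_mul_of_nonneg_right (le_max_left _ _) hε0.le)
    · exact (hC₁ _ _ _ _ _ hM _).trans (by gcongr)
    · exact (hD₁ _ hK).trans (by gcongr)
  · refine (integral_abs_sub_le (a := V α (lossLaw P Y Z φ (tunedK ε)) (ξs (tunedK ε))) (C := C₂)
      (D := |D₂|) hL2 hε0 ?_ ?_).trans (mul_le_mul_of_nonneg_right (le_max_right _ _) hε0.le)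
    · exact (hC₂ _ _ _ _ _ _ hM (hC₁ _ _ _ _ _ hM) _ (by omega)).trans (by gcongr)
    · refine (hD₂ _ hK).trans ?_
      have hb := bias_pos hK
      gcongr
      exact le_abs_self _

end Error

end NestedSA

open NestedSA in
theorem mainTheorem4 {Ω : Type*} [MeasurableSpace Ω] (P : Measure Ω) [IsProbabilityMeasure P]
    {d q : ℕ}
    (Y : Ω → EuclideanSpace ℝ (Fin d)) (Z : Ω → EuclideanSpace ℝ (Fin q))
    (hY : Measurable Y) (hZ : Measurable Z) (hYZ : IndepFun Y Z P)
    (φ : EuclideanSpace ℝ (Fin d) × EuclideanSpace ℝ (Fin q) → ℝ) (hφ : Measurable φ)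
    (hφ2 : MemLp (fun ω => φ (Y ω, Z ω)) 2 P)
    (α : ℝ) (hα0 : 0 < α) (hα1 : α < 1)
    -- the densities of the losses and the minimizers of the functions `V_h`
    (f : ℕ → ℝ → ℝ) (ξs : ℕ → ℝ)
    (hξs : ∀ K, ξs K ∈ argminV α (lossLaw P Y Z φ K))
    (hexp : LossExpansion α (lossLaw P Y Z φ) f)
    (hbounds : DensityBounds f (ξs 0))
    -- the random inputs of the algorithm
    (ξ0 χ0 : ℕ → Ω → ℝ)
    (S : (K : ℕ) → ℕ → Ω → EuclideanSpace ℝ (Fin d) × (Fin K → EuclideanSpace ℝ (Fin q)))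
    (hS : IsInput P Y Z ξ0 χ0 S)
    (hinit : InitialMoments P α f ξ0 χ0)
    (u : UnitCosts) :
    -- error and cost for all admissible learning rates
    (∀ β γ₁ : ℝ, Admissible (lambdaBar 1 α (lossLaw P Y Z φ) ξs) β γ₁ →
      (∃ C : ℝ, ∀ ε ∈ Set.Ioo (0 : ℝ) 1,
        Integrable (fun ω => (tunedRun u φ α ξ0 χ0 S β γ₁ ε ω).val.1) P ∧
        Integrable (fun ω => (tunedRun u φ α ξ0 χ0 S β γ₁ ε ω).val.2) P ∧
        ∫ ω, |(tunedRun u φ α ξ0 χ0 S β γ₁ ε ω).val.1 - ξs 0| ∂P ≤ C * ε ∧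
        ∫ ω, |(tunedRun u φ α ξ0 χ0 S β γ₁ ε ω).val.2 - V α (lossLaw P Y Z φ 0) (ξs 0)| ∂P
          ≤ C * ε) ∧
      (∃ C : ℝ, 0 < C ∧
        (∀ ε ∈ Set.Ioo (0 : ℝ) 1, ∀ ω, (tunedRun u φ α ξ0 χ0 S β γ₁ ε ω).cost
          ≤ C * (tunedN β ε : ℝ) * (bias (tunedK ε))⁻¹) ∧
        (fun ε : ℝ => C * (tunedN β ε : ℝ) * (bias (tunedK ε))⁻¹)
          ~[𝓝[>] 0] fun ε : ℝ => C * ε ^ (-(2 / β) - 1))) ∧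
    -- the minimal cost is of order `ε ^ (-3)` and is attained at `β = 1`, and only there
    (∃ γ₁ : ℝ, Admissible (lambdaBar 1 α (lossLaw P Y Z φ) ξs) 1 γ₁) ∧
    (∀ γ₁ : ℝ, Admissible (lambdaBar 1 α (lossLaw P Y Z φ) ξs) 1 γ₁ →
      (∃ c C : ℝ, 0 < c ∧ ∀ ε ∈ Set.Ioo (0 : ℝ) 1, ∀ ω,
        c * ε ^ (-3 : ℝ) ≤ (tunedRun u φ α ξ0 χ0 S 1 γ₁ ε ω).cost ∧
        (tunedRun u φ α ξ0 χ0 S 1 γ₁ ε ω).cost ≤ C * ε ^ (-3 : ℝ)) ∧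
      ∀ β γ₁' : ℝ, Admissible (lambdaBar 1 α (lossLaw P Y Z φ) ξs) β γ₁' →
        (∀ ε ∈ Set.Ioo (0 : ℝ) 1, ∀ ω,
          (tunedRun u φ α ξ0 χ0 S 1 γ₁ ε ω).cost
            ≤ (tunedRun u φ α ξ0 χ0 S β γ₁' ε ω).cost) ∧
        (β < 1 → ∀ δ > 0, ∀ᶠ ε in 𝓝[>] (0 : ℝ), ∀ ω,
          (tunedRun u φ α ξ0 χ0 S 1 γ₁ ε ω).cost
            ≤ δ * (tunedRun u φ α ξ0 χ0 S β γ₁' ε ω).cost)) := by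
  have hprob := isProbabilityMeasure_lossLaw (P := P) (φ := φ) hY hZ hφ
  have hLp := memLp_lossLaw hY hZ hYZ hφ hφ2
  have hint : ∀ K, Integrable id (lossLaw P Y Z φ K) := fun K => (hLp K).integrable one_le_two
  have hlam := lambdaBar_pos hα1 hint hξs hexp hbounds
  refine ⟨fun β γ₁ hadm => ⟨?_, ?_⟩, ?_, fun γ₁ hadm => ⟨?_, fun β γ₁' hadm' => ⟨?_, ?_⟩⟩⟩
  · exact exists_error_le hY hZ hYZ hφ hφ2 hα0 hα1 hξs hexp hbounds hS hinit u hadm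
  · refine ⟨u.total, u.total_pos, fun ε hε ω => ?_,
      tunedN_mul_tunedK_isEquivalent hadm.β_pos _⟩
    rw [cost_tunedRun]
    exact tunedCost_le u β hε.1
  -- Any multiple of `1 / lambdaBar` larger than 1 would do; positivity of `lambdaBar` is what makes
  -- the restriction satisfiable.
  · exact ⟨2 / lambdaBar 1 α (lossLaw P Y Z φ) ξs, one_pos, le_rfl, by positivity,
      fun _ => by rw [mul_div_cancel₀ _ hlam.ne']; norm_num⟩
  · refine ⟨u.drawZ, 4 * u.total, u.drawZ_pos, fun ε hε ω => ?_⟩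
    rw [cost_tunedRun]
    refine ⟨?_, tunedCost_one_le_rpow u hε.1 hε.2⟩
    have := le_tunedCost u 1 hε.1
    norm_num at this ⊢
    exact this
  · intro ε hε ω
    rw [cost_tunedRun, cost_tunedRun]
    exact tunedCost_one_le u hadm'.β_pos hadm'.β_le_one hε.1 hε.2
  · intro hβ δ hδ
    filter_upwards [tunedCost_isLittleO u hadm'.β_pos hβ hδ] with ε h ω
    rw [cost_tunedRun, cost_tunedRun]
    exact h
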